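/- Let $A$ be an $n\times n$ complex matrix with eigenvalues $\lambda_1(A),\dots,\lambda_n(A)$ (with algebraic multiplicity), let $c\in\mathbb R^n$, and put $H_\theta(A)=\frac12(e^{i\theta}A+e^{-i\theta}A^*)$, whose eigenvalues are ordered $\lambda_1(H_\theta(A))\ge\dots\ge\lambda_n(H_\theta(A))$. The weighted numerical range of $A$ is $$W(A;c)=\bigcap_{\theta}\Big\{v\in\mathbb C:\ \operatorname{Re}(e^{i\theta}v)\le \sum_{j=1}^n c_j\lambda_j(H_\theta(A))\Big\}.$$ A $c$-value of $A$ is a number $\sum_{i=1}^n c_i\lambda_{\sigma(i)}(A)$ with $\sigma$ a permutation of $\{1,\dots,n\}$. The $c$-polynomial $p(A;c)(t)$ is $\prod_d\big(t-\sum_j d_j\lambda_j(A)\big)$, where $d$ runs over the distinct rearrangements of the vector $c$, and $\deg(A;c)$ is its degree. For $1\le k\le n$, the rank-$k$ numerical range $\Lambda_k(A)$ is the set of $\lambda\in\mathbb C$ such that $PAP=\lambda P$ for some orthogonal projection $P$ of rank $k$. An ellipse with foci $f_1,f_2$ is a set $\{z\in\mathbb C: |z-f_1|+|z-f_2|=s\}$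 with $s>|f_1-f_2|$ (a circle, $f_1=f_2$, is allowed). If $\partial W(A;c)$ contains $2\deg(A;c)+1$ distinct points of an ellipse, then both foci of the ellipse are $c$-values of $A$. Moreover, for $1\le k\le n$, if $\partial\Lambda_k(A)$ contains an arc (with more than one point) of an ellipse, then both foci of that ellipse are eigenvalues of $A$. -/

import Mathlib

noncomputable section

namespace WNR

open Matrix

/-- `H_θ(A) = (e^{iθ} A + e^{-iθ} A*) / 2`. -/
def rotHerm {n : ℕ} (A : Matrix (Fin n) (Fin n) ℂ) (θ : ℝ) : Matrix (Fin n) (Fin n) ℂ :=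
  (1 / 2 : ℂ) • (Complex.exp (Complex.I * θ) • A + Complex.exp (-(Complex.I * θ)) • Aᴴ)

theorem rotHerm_isHermitian {n : ℕ} (A : Matrix (Fin n) (Fin n) ℂ) (θ : ℝ) :
    (rotHerm A θ).IsHermitian := by
  unfold Matrix.IsHermitian rotHerm
  simp only [conjTranspose_smul, conjTranspose_add, conjTranspose_conjTranspose,
    Complex.star_def, ← Complex.exp_conj, map_neg, map_mul, Complex.conj_I, Complex.conj_ofReal,
    map_div₀, map_one, map_ofNat, neg_mul, neg_neg]
  rw [add_comm]

/-- The eigenvalues of a Hermitian matrix with multiplicity, in decreasing order: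
`hermEig hH 0 ≥ hermEig hH 1 ≥ …`. -/
def hermEig {n : ℕ} {H : Matrix (Fin n) (Fin n) ℂ} (hH : H.IsHermitian) (j : Fin n) : ℝ :=
  hH.eigenvalues₀ (Fin.cast (Fintype.card_fin n).symm j)

/-- The weighted numerical range
`W(A;c) = ⋂_θ {v | Re (e^{iθ} v) ≤ c₁ λ₁(H_θ(A)) + ⋯ + cₙ λₙ(H_θ(A))}`. -/
def weightedRange {n : ℕ} (A : Matrix (Fin n) (Fin n) ℂ) (c : Fin n → ℝ) : Set ℂ :=
  ⋂ θ : ℝ, {v : ℂ | (Complex.exp (Complex.I * θ) * v).re ≤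
    ∑ j, c j * hermEig (rotHerm_isHermitian A θ) j}

/-- The rank-`k` numerical range: all `z` with `P A P = z P` for some orthogonal projection `P`
of rank `k`. -/
def rankRange {n : ℕ} (k : ℕ) (A : Matrix (Fin n) (Fin n) ℂ) : Set ℂ :=
  {z : ℂ | ∃ P : Matrix (Fin n) (Fin n) ℂ, P.IsHermitian ∧ P * P = P ∧ P.rank = k ∧
    P * A * P = z • P}

/-- An enumeration `λ₁(A), …, λₙ(A)` of the eigenvalues of `A` with algebraic multiplicity
(the default value `0` is never used, see `map_eig`). Nothing below depends on the order. -/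
def eig {n : ℕ} (A : Matrix (Fin n) (Fin n) ℂ) (j : Fin n) : ℂ :=
  A.charpoly.roots.toList.getD j 0

theorem map_eig {n : ℕ} (A : Matrix (Fin n) (Fin n) ℂ) :
    (Finset.univ : Finset (Fin n)).val.map (eig A) = A.charpoly.roots := by
  have hcard : A.charpoly.roots.toList.length = n := by
    rw [Multiset.length_toList, IsAlgClosed.card_roots_eq_natDegree,
      Matrix.charpoly_natDegree_eq_dim, Fintype.card_fin]
  have h : List.ofFn (eig A) = A.charpoly.roots.toList := by
    apply List.ext_getElem
    · simp [hcard]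
    · intro i h1 h2
      simp [eig, List.getElem?_eq_getElem h2]
  calc (Finset.univ : Finset (Fin n)).val.map (eig A) = (List.ofFn (eig A) : Multiset ℂ) := by
        simp [List.ofFn_eq_map]
    _ = A.charpoly.roots := by rw [h, Multiset.coe_toList]

/-- `z` is a `c`-value of `A`: it is of the form `∑ c_i λ_{j_i}(A)`, the sum over the indices with
`c_i ≠ 0`, with pairwise distinct indices `j_i`. (An injective choice of the `j_i` for the nonzero
entries is the restriction of a permutation, and the zero entries contribute nothing.) -/
def IsCValue {n : ℕ} (A : Matrix (Fin n) (Fin n) ℂ) (c : Fin n → ℝ) (z : ℂ) : Prop :=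
  ∃ σ : Equiv.Perm (Fin n), z = ∑ i, (c i : ℂ) * eig A (σ i)

open Classical in
/-- The distinct rearrangements of the entries of `c`. They are the coefficient vectors of the
generic `c`-values, i.e. of the distinct linear forms `∑ c_i X_{σ i}` in indeterminates `X_j`. -/
def rearrangements {n : ℕ} (c : Fin n → ℝ) : Finset (Fin n → ℝ) :=
  Finset.univ.image (fun σ : Equiv.Perm (Fin n) => c ∘ σ)

/-- The `c`-polynomial `p(A;c)(t)`: one linear factor for each generically distinct `c`-value. -/
def cPolynomial {n : ℕ} (A : Matrix (Fin n) (Fin n) ℂ) (c : Fin n → ℝ) : Polynomial ℂ :=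
  ∏ d ∈ rearrangements c, (Polynomial.X - Polynomial.C (∑ j, (d j : ℂ) * eig A j))

/-- `deg(A;c)`, the degree of the `c`-polynomial. -/
def cDegree {n : ℕ} (A : Matrix (Fin n) (Fin n) ℂ) (c : Fin n → ℝ) : ℕ :=
  (cPolynomial A c).natDegree

/-- The curve of all points whose distances to `f₁` and `f₂` add up to `s`. For
`dist f₁ f₂ < s` it is the (nondegenerate) ellipse with foci `f₁`, `f₂` and major axis `s`. -/
def ellipse (f₁ f₂ : ℂ) (s : ℝ) : Set ℂ :=
  {z : ℂ | dist z f₁ + dist z f₂ = s}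

/-- A nondegenerate arc of the ellipse: a connected subset with more than one point. -/
def IsEllipticalArc (f₁ f₂ : ℂ) (s : ℝ) (S : Set ℂ) : Prop :=
  S ⊆ ellipse f₁ f₂ s ∧ IsConnected S ∧ S.Nontrivial

end WNR

end

namespace WNR

open Matrix Polynomial


/-! Put h(x) = ∑ c_j λ_j(Re xA), so that W(A;c) is cut out by the inequalities Re(xv) ≤ h(x). A
boundary point of W(A;c) lies on one of the lines Re(xv) = h(x). If it is also on the ellipse, an
intermediate value argument between the normal of the ellipse and the direction of that line yields
a direction x in which h agrees with the support function of the ellipse. Strict convexity puts the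
directions of different points on different rays (`exists_common_tangent`).

By the fundamental theorem of symmetric polynomials, the value at W of the c-polynomial of (XA +
YA*)/2 is a form of degree m = deg(A;c) in (X, Y, W), and it vanishes at (x, x̄, h(x)). The tangent
lines of the ellipse form a conic with a quadratic parametrisation by τ, so on them the form becomes
a polynomial in τ of degree at most 2m. With 2m+1 zeros it vanishes identically. The value τ = 0 is
the isotropic tangent through f₁, where Y = 0 and the form is, up to a nonzero factor, the
c-polynomial of A at f₁ (`isCValue_of_tangents`).

For Λ_k take c = e_k. The same argument applies once Λ_k(A) is known to lie between the open and the
closed intersection of the half-planes. The closed bound is Courant-Fischer. The open one says: if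
the k-th eigenvalue of Re(xB) is positive for all unit x, then B is compressed to zero by a
projection of rank k (`exists_projection_of_hermEig_pos`). Compactness of the projections allows B
to be perturbed until the pencil of Re B and Im B is simple. In its eigenvector coordinates the
upper half-plane part is isotropic, and the real part gives two real diagonal forms. A combination
of these with the fewest positive entries has interlacing ratios on its positive and negative
entries, and the theorem of Fan and Pall then gives a common isotropic subspace. -/

/-! ### Quadratic forms and ordered eigenvalues of Hermitian matrices -/

/-- The real part of the quadratic form `v ↦ v* H v`. -/
noncomputable def hform {n : ℕ} (H : Matrix (Fin n) (Fin n) ℂ) (v : Fin n → ℂ) : ℝ :=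
  (star v ⬝ᵥ (H *ᵥ v)).re

/-- `(x A + x̄ A*) / 2`. -/
noncomputable def herm {n : ℕ} (x : ℂ) (A : Matrix (Fin n) (Fin n) ℂ) :
    Matrix (Fin n) (Fin n) ℂ :=
  (1 / 2 : ℂ) • (x • A + star x • Aᴴ)

theorem herm_isHermitian {n : ℕ} (x : ℂ) (A : Matrix (Fin n) (Fin n) ℂ) :
    (herm x A).IsHermitian := by
  unfold Matrix.IsHermitian herm
  simp only [conjTranspose_smul, conjTranspose_add, conjTranspose_conjTranspose, star_star]
  rw [add_comm]
  simp

theorem rotHerm_eq_herm {n : ℕ} (A : Matrix (Fin n) (Fin n) ℂ) (θ : ℝ) :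
    rotHerm A θ = herm (Complex.exp (Complex.I * θ)) A := by
  unfold rotHerm herm
  simp [← Complex.exp_conj]

theorem hform_one {n : ℕ} (v : Fin n → ℂ) : hform 1 v = ∑ i, ‖v i‖ ^ 2 := by
  simp [hform, dotProduct, ← Complex.normSq_eq_norm_sq, Complex.normSq_apply]

theorem hform_one_pos {n : ℕ} {v : Fin n → ℂ} (hv : v ≠ 0) : 0 < hform 1 v := by
  rw [hform_one]
  obtain ⟨i, hi⟩ := Function.ne_iff.mp hv
  have : 0 < ‖v i‖ ^ 2 := by have := norm_pos_iff.mpr hi; positivity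
  exact this.trans_le (Finset.single_le_sum (f := fun i => ‖v i‖ ^ 2)
    (fun i _ => by positivity) (Finset.mem_univ i))

theorem hform_add {n : ℕ} (H K : Matrix (Fin n) (Fin n) ℂ) (v : Fin n → ℂ) :
    hform (H + K) v = hform H v + hform K v := by
  simp [hform, add_mulVec, dotProduct_add]

theorem hform_real_smul {n : ℕ} (r : ℝ) (H : Matrix (Fin n) (Fin n) ℂ) (v : Fin n → ℂ) :
    hform ((r : ℂ) • H) v = r * hform H v := by
  simp [hform, smul_mulVec, dotProduct_smul]

theorem exists_unitary_hermEig {n : ℕ} {H : Matrix (Fin n) (Fin n) ℂ} (hH : H.IsHermitian) :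
    ∃ U : Matrix (Fin n) (Fin n) ℂ, Uᴴ * U = 1 ∧
      H = U * diagonal (fun j => (hermEig hH j : ℂ)) * Uᴴ := by
  -- `eigenvalues` is the ordered list `eigenvalues₀` reindexed by an arbitrary bijection; σ undoes
  -- this.
  let σ : Fin n ≃ Fin n :=
    (finCongr (Fintype.card_fin n).symm).trans (Fintype.equivOfCardEq (Fintype.card_fin _))
  have hσ : ∀ j, hermEig hH j = hH.eigenvalues (σ j) := fun j => by
    simp [hermEig, Matrix.IsHermitian.eigenvalues, σ]
  let V : Matrix (Fin n) (Fin n) ℂ := hH.eigenvectorUnitary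
  have hV : Vᴴ * V = 1 := by
    simpa [star_eq_conjTranspose] using Unitary.coe_star_mul_self hH.eigenvectorUnitary
  have hs : H = V * diagonal (fun j => (hH.eigenvalues j : ℂ)) * Vᴴ := by
    have := hH.spectral_theorem
    rw [Unitary.conjStarAlgAut_apply] at this
    exact this
  refine ⟨V.submatrix id σ, ?_, ?_⟩
  · have h := submatrix_mul_equiv Vᴴ V σ (Equiv.refl _) σ
    rw [hV, submatrix_one_equiv] at h
    rw [conjTranspose_submatrix]
    exact h
  · have h1 : diagonal (fun j => (hermEig hH j : ℂ)) =
        (diagonal (fun j => (hH.eigenvalues j : ℂ))).submatrix σ σ := by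
      rw [submatrix_diagonal_equiv]; congr 1; ext j; simp [hσ]
    rw [h1, conjTranspose_submatrix, submatrix_mul_equiv, submatrix_mul_equiv, ← hs]
    simp

theorem hermEig_antitone {n : ℕ} {H : Matrix (Fin n) (Fin n) ℂ} (hH : H.IsHermitian) :
    Antitone (hermEig hH) := fun _ _ hij =>
  hH.eigenvalues₀_antitone (Fin.le_def.mpr (Fin.le_def.mp hij))

theorem hform_mul_diagonal {n : ℕ} (U : Matrix (Fin n) (Fin n) ℂ) (d : Fin n → ℝ)
    (v : Fin n → ℂ) :
    hform (U * diagonal (fun j => (d j : ℂ)) * Uᴴ) v = ∑ i, d i * ‖(Uᴴ *ᵥ v) i‖ ^ 2 := by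
  have : star v ⬝ᵥ ((U * diagonal (fun j => (d j : ℂ)) * Uᴴ) *ᵥ v) =
      star (Uᴴ *ᵥ v) ⬝ᵥ (diagonal (fun j => (d j : ℂ)) *ᵥ (Uᴴ *ᵥ v)) := by
    rw [star_mulVec, conjTranspose_conjTranspose, ← dotProduct_mulVec, mulVec_mulVec,
      mulVec_mulVec, Matrix.mul_assoc]
  rw [hform, this]
  simp only [dotProduct, mulVec_diagonal, Complex.re_sum]
  refine Finset.sum_congr rfl fun i _ => ?_
  simp [← Complex.normSq_eq_norm_sq, Complex.normSq_apply]
  ring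

/-- Courant-Fischer: by dimension, W contains a nonzero vector orthogonal to the first j
eigenvectors, and there the Rayleigh quotient is at most the eigenvalue with index j. -/
theorem le_hermEig {n : ℕ} {H : Matrix (Fin n) (Fin n) ℂ} (hH : H.IsHermitian) (j : Fin n)
    (W : Submodule ℂ (Fin n → ℂ)) (hW : (j : ℕ) < Module.finrank ℂ W) (a : ℝ)
    (ha : ∀ v ∈ W, a * hform 1 v ≤ hform H v) : a ≤ hermEig hH j := by
  obtain ⟨U, hU, hHU⟩ := exists_unitary_hermEig hH
  let f : W →ₗ[ℂ] (Fin j → ℂ) :=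
    (LinearMap.pi fun i : Fin j => LinearMap.proj (i.castLE j.2.le)).comp
      ((Matrix.mulVecLin Uᴴ).comp W.subtype)
  have hker : LinearMap.ker f ≠ ⊥ := LinearMap.ker_ne_bot_of_finrank_lt (by simpa using hW)
  obtain ⟨w, hw, hw0⟩ := (Submodule.ne_bot_iff _).mp hker
  have hz : ∀ i : Fin n, i < j → (Uᴴ *ᵥ (w : Fin n → ℂ)) i = 0 := fun i hi => by
    have := congrFun (LinearMap.mem_ker.mp hw) ⟨i, hi⟩
    simpa [f] using this
  have h1 : hform H w ≤ hermEig hH j * hform 1 (w : Fin n → ℂ) := by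
    have e1 : hform 1 (w : Fin n → ℂ) = ∑ i, (1 : ℝ) * ‖(Uᴴ *ᵥ (w : Fin n → ℂ)) i‖ ^ 2 := by
      rw [← hform_mul_diagonal]
      simp [mul_eq_one_comm.mp hU]
    have e2 : hform H w = ∑ i, hermEig hH i * ‖(Uᴴ *ᵥ (w : Fin n → ℂ)) i‖ ^ 2 := by
      rw [← hform_mul_diagonal, ← hHU]
    rw [e1, e2, Finset.mul_sum]
    refine Finset.sum_le_sum fun i _ => ?_
    rcases lt_or_ge i j with h | h
    · simp [hz i h]
    · rw [one_mul]
      exact mul_le_mul_of_nonneg_right (hermEig_antitone hH h) (by positivity)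
  have h2 := (ha w w.2).trans h1
  exact le_of_mul_le_mul_right h2 (hform_one_pos (by simpa using hw0))

/-- The span of the first j + 1 eigenvectors attains the Courant-Fischer bound. -/
theorem exists_submodule_hermEig {n : ℕ} {H : Matrix (Fin n) (Fin n) ℂ} (hH : H.IsHermitian)
    (j : Fin n) : ∃ W : Submodule ℂ (Fin n → ℂ), Module.finrank ℂ W = j + 1 ∧
      ∀ v ∈ W, hermEig hH j * hform 1 v ≤ hform H v := by
  obtain ⟨U, hU, hHU⟩ := exists_unitary_hermEig hH
  let E : Matrix (Fin n) (Fin (j + 1)) ℂ := U.submatrix id (Fin.castLE j.2)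
  have hE : Eᴴ * E = 1 := by
    ext a b
    have := congrFun (congrFun hU (Fin.castLE j.2 a)) (Fin.castLE j.2 b)
    simpa [E, mul_apply, one_apply] using this
  have hinj : Function.Injective (Matrix.mulVecLin E) := fun x y hxy => by
    have := congrArg (fun z => Eᴴ *ᵥ z) hxy
    simpa [mulVec_mulVec, hE] using this
  refine ⟨LinearMap.range (Matrix.mulVecLin E), ?_, ?_⟩
  · rw [LinearMap.finrank_range_of_inj hinj]; simp
  · rintro _ ⟨x, rfl⟩
    have hz : ∀ i : Fin n, j < i → (Uᴴ *ᵥ (E *ᵥ x)) i = 0 := fun i hi => by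
      rw [mulVec_mulVec]
      change ∑ b, (Uᴴ * E) i b * x b = 0
      refine Finset.sum_eq_zero fun b _ => ?_
      have := congrFun (congrFun hU i) (Fin.castLE j.2 b)
      rw [one_apply_ne] at this
      · simp only [mul_apply, E, submatrix_apply, id] at this ⊢
        rw [this, zero_mul]
      · rintro rfl
        have := b.2
        simp [Fin.lt_def] at hi
        omega
    rw [mulVecLin_apply]
    set w := E *ᵥ x
    have e1 : hform 1 w = ∑ i, (1 : ℝ) * ‖(Uᴴ *ᵥ w) i‖ ^ 2 := by
      rw [← hform_mul_diagonal]
      simp [mul_eq_one_comm.mp hU]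
    have e2 : hform H w = ∑ i, hermEig hH i * ‖(Uᴴ *ᵥ w) i‖ ^ 2 := by
      rw [← hform_mul_diagonal, ← hHU]
    rw [e1, e2, Finset.mul_sum]
    refine Finset.sum_le_sum fun i _ => ?_
    rcases lt_or_ge j i with h | h
    · simp [hz i h]
    · rw [one_mul]
      exact mul_le_mul_of_nonneg_right (hermEig_antitone hH h) (by positivity)

/-- Comparison of ordered eigenvalues through the quadratic forms. -/
theorem hermEig_le_of_hform {n : ℕ} {H K : Matrix (Fin n) (Fin n) ℂ} (hH : H.IsHermitian)
    (hK : K.IsHermitian) {r ε : ℝ} (hr : 0 ≤ r)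
    (h : ∀ v, r * hform H v - ε * hform 1 v ≤ hform K v) (j : Fin n) :
    r * hermEig hH j - ε ≤ hermEig hK j := by
  obtain ⟨W, hW, hWv⟩ := exists_submodule_hermEig hH j
  refine le_hermEig hK j W (by omega) _ fun v hv => ?_
  have := mul_le_mul_of_nonneg_left (hWv v hv) hr
  linarith [h v]

theorem hermEig_smul {n : ℕ} {H K : Matrix (Fin n) (Fin n) ℂ} (hH : H.IsHermitian)
    (hK : K.IsHermitian) {r : ℝ} (hr : 0 < r) (hKH : K = (r : ℂ) • H) (j : Fin n) :
    hermEig hK j = r * hermEig hH j := by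
  subst hKH
  apply le_antisymm
  · have := hermEig_le_of_hform hK hH (r := r⁻¹) (ε := 0) (by positivity) (fun v => by
      rw [hform_real_smul]; field_simp; simp) j
    rw [sub_zero, inv_mul_le_iff₀ hr] at this
    exact this
  · simpa using hermEig_le_of_hform hH hK (ε := 0) hr.le (fun v => by
      rw [hform_real_smul]; simp) j

theorem hform_le_sum_norm {n : ℕ} (H : Matrix (Fin n) (Fin n) ℂ) (v : Fin n → ℂ) :
    |hform H v| ≤ (∑ i, ∑ j, ‖H i j‖) * hform 1 v := by
  have h1 : |hform H v| ≤ ∑ i, ∑ j, ‖v i‖ * (‖H i j‖ * ‖v j‖) := by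
    refine (Complex.abs_re_le_norm _).trans ((norm_sum_le _ _).trans ?_)
    refine Finset.sum_le_sum fun i _ => ?_
    rw [norm_mul, ← Finset.mul_sum]
    simp only [Pi.star_apply, norm_star]
    refine mul_le_mul_of_nonneg_left ((norm_sum_le Finset.univ fun j => H i j * v j).trans ?_)
      (norm_nonneg _)
    exact Finset.sum_le_sum fun j _ => (norm_mul _ _).le
  refine h1.trans ?_
  rw [Finset.sum_mul]
  refine Finset.sum_le_sum fun i _ => ?_
  rw [Finset.sum_mul]
  refine Finset.sum_le_sum fun j _ => ?_
  have hb : ∀ i, ‖v i‖ ^ 2 ≤ hform 1 v := fun i => by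
    rw [hform_one]
    exact Finset.single_le_sum (f := fun i => ‖v i‖ ^ 2) (fun i _ => by positivity)
      (Finset.mem_univ i)
  have h2 : ‖v i‖ * ‖v j‖ ≤ hform 1 v := by
    nlinarith [hb i, hb j, sq_nonneg (‖v i‖ - ‖v j‖)]
  nlinarith [norm_nonneg (H i j), mul_le_mul_of_nonneg_left h2 (norm_nonneg (H i j))]

/-- Weyl's perturbation bound: an eigenvalue moves by at most any ε for which the difference of the
two forms is bounded by ε‖v‖², for instance the sum of the absolute values of the entries of the
difference. -/
theorem continuous_hermEig {n : ℕ} {X : Type*} [TopologicalSpace X]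
    {F : X → Matrix (Fin n) (Fin n) ℂ} (hF : ∀ x, (F x).IsHermitian) (hc : Continuous F)
    (j : Fin n) : Continuous fun x => hermEig (hF x) j := by
  rw [continuous_iff_continuousAt]
  intro x₀
  have hg : Continuous fun x => ∑ i, ∑ l, ‖(F x - F x₀) i l‖ := by
    refine continuous_finsetSum _ fun i _ => continuous_finsetSum _ fun l _ => ?_
    exact ((hc.sub continuous_const).matrix_elem i l).norm
  have h0 : Filter.Tendsto (fun x => ∑ i, ∑ l, ‖(F x - F x₀) i l‖) (nhds x₀) (nhds 0) := by
    simpa using hg.tendsto x₀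
  rw [ContinuousAt, tendsto_iff_dist_tendsto_zero]
  refine squeeze_zero (fun _ => dist_nonneg) (fun x => ?_) h0
  have hd : ∀ v, hform (F x) v = hform (F x₀) v + hform (F x - F x₀) v := fun v => by
    rw [← hform_add]; simp
  have h1 := hermEig_le_of_hform (hF x) (hF x₀) zero_le_one
    (ε := ∑ i, ∑ l, ‖(F x - F x₀) i l‖) (fun v => by
      have := abs_le.mp (hform_le_sum_norm (F x - F x₀) v)
      linarith [hd v, this.2]) j
  have h2 := hermEig_le_of_hform (hF x₀) (hF x) zero_le_one
    (ε := ∑ i, ∑ l, ‖(F x - F x₀) i l‖) (fun v => by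
      have := abs_le.mp (hform_le_sum_norm (F x - F x₀) v)
      linarith [hd v, this.1]) j
  rw [Real.dist_eq, abs_le]
  constructor <;> linarith


/-! ### The c-polynomial as a form in the matrix and the argument -/

theorem cPolynomial_eval {n : ℕ} (M : Matrix (Fin n) (Fin n) ℂ) (c : Fin n → ℝ) (w : ℂ) :
    (cPolynomial M c).eval w = ∏ d ∈ rearrangements c, (w - ∑ j, (d j : ℂ) * eig M j) := by
  simp [cPolynomial, eval_prod, eval_finsetSum]

theorem cDegree_eq_card {n : ℕ} (M : Matrix (Fin n) (Fin n) ℂ) (c : Fin n → ℝ) :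
    cDegree M c = (rearrangements c).card := by
  rw [cDegree, cPolynomial, natDegree_prod_of_monic _ _ fun d _ => monic_X_sub_C _,
    Finset.card_eq_sum_ones]
  exact Finset.sum_congr rfl fun d _ => natDegree_X_sub_C _

theorem mem_rearrangements {n : ℕ} {c d : Fin n → ℝ} :
    d ∈ rearrangements c ↔ ∃ σ : Equiv.Perm (Fin n), c ∘ σ = d := by
  simp [rearrangements]

theorem isCValue_of_cPolynomial_eval {n : ℕ} {A : Matrix (Fin n) (Fin n) ℂ} {c : Fin n → ℝ}
    {z : ℂ} (h : (cPolynomial A c).eval z = 0) : IsCValue A c z := by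
  rw [cPolynomial_eval, Finset.prod_eq_zero_iff] at h
  obtain ⟨d, hd, hz⟩ := h
  obtain ⟨σ, rfl⟩ := mem_rearrangements.mp hd
  refine ⟨σ⁻¹, ?_⟩
  rw [sub_eq_zero.mp hz, ← Equiv.sum_comp σ fun i => (c i : ℂ) * eig A (σ⁻¹ i)]
  simp

/-- The `c`-polynomial is a polynomial in the elementary symmetric functions of the eigenvalues. -/
theorem exists_esymm_prod {n : ℕ} (c : Fin n → ℝ) :
    ∃ G : MvPolynomial (Fin n) ℂ[X], ∀ (f : Fin n → ℂ) (w : ℂ),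
      ∏ d ∈ rearrangements c, (w - ∑ j, (d j : ℂ) * f j) =
        MvPolynomial.eval₂ (evalRingHom w)
          (fun i : Fin n => ((Finset.univ : Finset (Fin n)).val.map f).esymm (i + 1)) G := by
  -- The coefficient ring ℂ[X] carries the argument w of the c-polynomial; the indeterminates stand
  -- for the eigenvalues. Permuting them permutes the factors.
  let S : MvPolynomial (Fin n) ℂ[X] := ∏ d ∈ rearrangements c,
    (MvPolynomial.C X - ∑ j, MvPolynomial.C (C (d j : ℂ)) * MvPolynomial.X j)
  have hS : S.IsSymmetric := fun σ => by
    simp only [S, map_prod, map_sub, map_sum, map_mul, MvPolynomial.rename_C,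
      MvPolynomial.rename_X]
    refine Finset.prod_bij (fun d _ => d ∘ σ.symm) ?_ ?_ ?_ ?_
    · intro d hd
      obtain ⟨τ, rfl⟩ := mem_rearrangements.mp hd
      exact mem_rearrangements.mpr ⟨σ.symm.trans τ, rfl⟩
    · intro d _ e _ h
      exact σ.symm.surjective.injective_comp_right h
    · intro d hd
      obtain ⟨τ, rfl⟩ := mem_rearrangements.mp hd
      refine ⟨c ∘ (σ.trans τ), mem_rearrangements.mpr ⟨_, rfl⟩, ?_⟩
      ext i; simp
    · intro d _
      congr 1
      rw [← Equiv.sum_comp σ (fun j => MvPolynomial.C (C (((d ∘ σ.symm) j : ℝ) : ℂ)) *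
        (MvPolynomial.X j : MvPolynomial (Fin n) ℂ[X]))]
      simp
  obtain ⟨G, hG⟩ := MvPolynomial.esymmAlgHom_surjective (σ := Fin n) ℂ[X]
    (n := n) (by simp) ⟨S, hS⟩
  have hG' : MvPolynomial.aeval (fun i : Fin n => MvPolynomial.esymm (Fin n) ℂ[X] (i + 1)) G = S := by
    rw [← MvPolynomial.esymmAlgHom_apply, hG]
  refine ⟨G, fun f w => ?_⟩
  have h1 : ∏ d ∈ rearrangements c, (w - ∑ j, (d j : ℂ) * f j) =
      MvPolynomial.eval₂ (evalRingHom w) f S := by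
    rw [← MvPolynomial.coe_eval₂Hom]
    simp only [S, map_prod, map_sub, map_sum, map_mul, MvPolynomial.eval₂Hom_C,
      MvPolynomial.eval₂Hom_X']
    simp
  rw [h1, ← hG']
  -- With ℂ an algebra over ℂ[X] through evaluation at w, `eval₂` becomes `aeval`.
  let _ : Algebra ℂ[X] ℂ := (evalRingHom w).toAlgebra
  have h2 : ∀ p : MvPolynomial (Fin n) ℂ[X], ∀ g : Fin n → ℂ,
      MvPolynomial.eval₂ (evalRingHom w) g p = MvPolynomial.aeval g p := fun p g => rfl
  rw [h2, h2, MvPolynomial.comp_aeval_apply]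
  simp only [MvPolynomial.aeval_esymm_eq_multiset_esymm]

theorem esymm_roots_charpoly {n : ℕ} (M : Matrix (Fin n) (Fin n) ℂ) (i : Fin n) :
    M.charpoly.roots.esymm (i + 1) = (-1) ^ ((i : ℕ) + 1) * M.charpoly.coeff (n - (i + 1)) := by
  have hd : M.charpoly.natDegree = n := by
    rw [Matrix.charpoly_natDegree_eq_dim, Fintype.card_fin]
  have h := Polynomial.coeff_eq_esymm_roots_of_card (p := M.charpoly)
    IsAlgClosed.card_roots_eq_natDegree (k := n - (i + 1)) (by omega)
  have h2 : n - (n - ((i : ℕ) + 1)) = i + 1 := by omega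
  rw [hd, h2, M.charpoly_monic.leadingCoeff, one_mul] at h
  rw [h, ← mul_assoc, ← mul_pow]
  simp

theorem prod_eq_cPolynomial_eval {n : ℕ} (M : Matrix (Fin n) (Fin n) ℂ) (c : Fin n → ℝ)
    {f : Fin n → ℂ} (hf : (Finset.univ : Finset (Fin n)).val.map f = M.charpoly.roots) (w : ℂ) :
    (cPolynomial M c).eval w = ∏ d ∈ rearrangements c, (w - ∑ j, (d j : ℂ) * f j) := by
  obtain ⟨G, hG⟩ := exists_esymm_prod c
  rw [cPolynomial_eval, hG, hG, map_eig, hf]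

/-- The value of the `c`-polynomial depends polynomially on the matrix and the argument. -/
theorem exists_polynomial_cPolynomial_eval {n : ℕ} (c : Fin n → ℝ)
    (M : Matrix (Fin n) (Fin n) ℂ[X]) (w : ℂ[X]) :
    ∃ P : ℂ[X], ∀ t : ℂ,
      P.eval t = (cPolynomial (M.map (eval t)) c).eval (w.eval t) := by
  obtain ⟨G, hG⟩ := exists_esymm_prod c
  -- By Vieta, the elementary symmetric functions of the eigenvalues are signed coefficients of the
  -- characteristic polynomial, which are polynomial in the parameter.
  refine ⟨MvPolynomial.eval₂ (compRingHom w)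
    (fun i : Fin n => (-1) ^ ((i : ℕ) + 1) * M.charpoly.coeff (n - (i + 1))) G, fun t => ?_⟩
  rw [cPolynomial_eval, hG, map_eig, ← coe_evalRingHom t, MvPolynomial.hom_eval₂]
  congr 1
  · refine Polynomial.ringHom_ext (fun a => ?_) ?_ <;> simp
  · ext i
    rw [esymm_roots_charpoly, Matrix.charpoly_map]
    simp

theorem roots_charpoly_smul {n : ℕ} (M : Matrix (Fin n) (Fin n) ℂ) {t : ℂ} (ht : t ≠ 0) :
    (Finset.univ : Finset (Fin n)).val.map (fun j => t * eig M j) =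
      (t • M).charpoly.roots := by
  have h : (t • M).charpoly =
      ((Finset.univ : Finset (Fin n)).val.map fun j => X - C (t * eig M j)).prod := by
    refine Polynomial.funext fun x => ?_
    have hM : M.charpoly =
        ((Finset.univ : Finset (Fin n)).val.map fun j => X - C (eig M j)).prod := by
      conv_lhs => rw [← Polynomial.prod_multiset_X_sub_C_of_monic_of_roots_card_eq M.charpoly_monic
        IsAlgClosed.card_roots_eq_natDegree, ← map_eig, Multiset.map_map]
      rfl
    have h1 := congrArg (eval (x / t)) hM
    rw [eval_charpoly] at h1 ⊢
    have h2 : scalar (Fin n) x - t • M = t • (scalar (Fin n) (x / t) - M) := by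
      rw [smul_sub]
      congr 1
      ext i j
      simp [diagonal_apply, mul_div_cancel₀ x ht]
    rw [h2, det_smul, h1, Finset.prod_map_val, Finset.prod_map_val, eval_prod, eval_prod,
      ← Finset.card_univ, ← Finset.prod_const, ← Finset.prod_mul_distrib]
    refine Finset.prod_congr rfl fun j _ => ?_
    simp
    field_simp
  rw [h, Finset.prod_map_val, Polynomial.roots_prod _ _
    (Finset.prod_ne_zero_iff.mpr fun j _ => X_sub_C_ne_zero _)]
  simp only [roots_X_sub_C, Multiset.bind_singleton]

/-- Joint homogeneity in matrix and argument. Vanishing therefore depends only on the line with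
homogeneous coordinates (X, Y, W), which permits rescaling a parametrisation. -/
theorem cPolynomial_eval_smul {n : ℕ} (M : Matrix (Fin n) (Fin n) ℂ) (c : Fin n → ℝ) {t : ℂ}
    (ht : t ≠ 0) (w : ℂ) : (cPolynomial (t • M) c).eval (t * w) =
      t ^ (rearrangements c).card * (cPolynomial M c).eval w := by
  rw [prod_eq_cPolynomial_eval _ c (roots_charpoly_smul M ht), cPolynomial_eval,
    ← Finset.prod_const, ← Finset.prod_mul_distrib]
  refine Finset.prod_congr rfl fun d _ => ?_
  rw [mul_sub, Finset.mul_sum]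
  congr 1
  exact Finset.sum_congr rfl fun j _ => by ring

/-- The factor of the unpermuted vector c vanishes. This replaces the support function, which need
not be smooth, by an algebraic equation. -/
theorem cPolynomial_eval_hermEig {n : ℕ} {H : Matrix (Fin n) (Fin n) ℂ} (hH : H.IsHermitian)
    (c : Fin n → ℝ) :
    (cPolynomial H c).eval ((∑ j, c j * hermEig hH j : ℝ) : ℂ) = 0 := by
  have hf : (Finset.univ : Finset (Fin n)).val.map (fun j => (hermEig hH j : ℂ)) =
      H.charpoly.roots := by
    rw [hH.roots_charpoly_eq_eigenvalues₀]
    have := Multiset.map_univ_val_equiv (finCongr (Fintype.card_fin n).symm)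
    rw [← this, Multiset.map_map]
    rfl
  rw [prod_eq_cPolynomial_eval H c hf, Finset.prod_eq_zero_iff]
  exact ⟨c, mem_rearrangements.mpr ⟨1, rfl⟩, by simp⟩

/-- A polynomial with `p(t) = t^m q(1/t)` for a polynomial `q` has degree at most `m`. -/
theorem natDegree_le_of_eval_inv {p q : ℂ[X]} {m : ℕ}
    (h : ∀ t : ℂ, t ≠ 0 → p.eval t = t ^ m * q.eval t⁻¹) : p.natDegree ≤ m := by
  -- Clearing denominators turns q(1/t) into the reversed polynomial; the identity holds at all t ≠
  -- 0, hence formally, and degrees can be compared.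
  have key : p * X ^ q.natDegree = X ^ m * q.reverse := by
    refine Polynomial.eq_of_infinite_eval_eq _ _ ?_
    refine Set.Infinite.mono (s := {0}ᶜ) (fun t ht => ?_) (Set.finite_singleton (0 : ℂ)).infinite_compl
    have ht0 : t ≠ 0 := ht
    let _ : Invertible t⁻¹ := invertibleOfNonzero (inv_ne_zero ht0)
    have hr := Polynomial.eval₂_reverse_mul_pow (RingHom.id ℂ) t⁻¹ q
    simp only [invOf_eq_inv, inv_inv] at hr
    change eval t q.reverse * _ = eval t⁻¹ q at hr
    simp only [Set.mem_ofPred_eq, eval_mul, eval_pow, eval_X]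
    rw [h t ht0, ← hr, mul_assoc, mul_assoc, ← mul_pow, inv_mul_cancel₀ ht0, one_pow, mul_one]
  by_cases hp : p = 0
  · simp [hp]
  have h1 : (p * X ^ q.natDegree).natDegree = p.natDegree + q.natDegree :=
    natDegree_mul_X_pow _ hp
  have h2 : (X ^ m * q.reverse).natDegree ≤ m + q.natDegree :=
    natDegree_mul_le.trans (by simpa using q.reverse_natDegree_le)
  rw [key] at h1
  omega


/-! ### The support function and the tangents of an ellipse -/

/-- The support function of the ellipse with foci `f₁`, `f₂` and major axis `s`. -/
noncomputable def ellipseSupport (f₁ f₂ : ℂ) (s : ℝ) (x : ℂ) : ℝ :=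
  (x * (f₁ + f₂)).re / 2 +
    √((x * (f₂ - f₁)).re ^ 2 + (s ^ 2 - dist f₁ f₂ ^ 2) * ‖x‖ ^ 2) / 2

theorem continuous_ellipseSupport (f₁ f₂ : ℂ) (s : ℝ) : Continuous (ellipseSupport f₁ f₂ s) := by
  unfold ellipseSupport
  fun_prop

theorem axis_sq_sub_pos {f₁ f₂ : ℂ} {s : ℝ} (hs : dist f₁ f₂ < s) :
    0 < s ^ 2 - dist f₁ f₂ ^ 2 := by
  nlinarith [dist_nonneg (x := f₁) (y := f₂)]

theorem ellipseSupport_radicand_pos {f₁ f₂ : ℂ} {s : ℝ} (hs : dist f₁ f₂ < s) {x : ℂ}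
    (hx : x ≠ 0) : 0 < (x * (f₂ - f₁)).re ^ 2 + (s ^ 2 - dist f₁ f₂ ^ 2) * ‖x‖ ^ 2 := by
  have h1 := axis_sq_sub_pos hs
  have h2 := norm_pos_iff.mpr hx
  positivity

/-- The radicand in the support function exceeds the square of its value at a point of the ellipse
by a quantity that vanishes exactly in the normal direction. -/
theorem radicand_sub_sq {f₁ f₂ z : ℂ} {s : ℝ} (hz : z ∈ ellipse f₁ f₂ s) (x : ℂ) :
    (x * (f₂ - f₁)).re ^ 2 + (s ^ 2 - dist f₁ f₂ ^ 2) * ‖x‖ ^ 2 -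
      (x * (z - f₁) + x * (z - f₂)).re ^ 2 =
    2 * (‖x * (z - f₁) * (x * (z - f₂))‖ - (x * (z - f₁) * (x * (z - f₂))).re) := by
  have hz' : ‖z - f₁‖ + ‖z - f₂‖ = s := by simpa [ellipse, dist_eq_norm] using hz
  have h1 : dist f₁ f₂ ^ 2 = ‖z - f₁‖ ^ 2 + ‖z - f₂‖ ^ 2
      - 2 * ((z - f₁).re * (z - f₂).re + (z - f₁).im * (z - f₂).im) := by
    rw [dist_eq_norm, ← Complex.normSq_eq_norm_sq, ← Complex.normSq_eq_norm_sq,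
      ← Complex.normSq_eq_norm_sq]
    simp only [Complex.normSq_apply, Complex.sub_re, Complex.sub_im]
    ring
  have h2 : ‖x‖ ^ 2 = x.re * x.re + x.im * x.im := by
    rw [← Complex.normSq_eq_norm_sq, Complex.normSq_apply]
  have h3 : ‖x * (z - f₁) * (x * (z - f₂))‖ = ‖x‖ ^ 2 * (‖z - f₁‖ * ‖z - f₂‖) := by
    simp only [norm_mul]; ring
  have h4 : f₂ - f₁ = (z - f₁) - (z - f₂) := by ring
  rw [h3, h1, ← hz', h2, h4]
  generalize z - f₁ = u, z - f₂ = v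
  simp only [Complex.mul_re, Complex.mul_im, Complex.add_re, Complex.sub_re, Complex.sub_im]
  ring

theorem ellipseSupport_sub (f₁ f₂ : ℂ) (s : ℝ) (x z : ℂ) :
    ellipseSupport f₁ f₂ s x - (x * z).re =
      (√((x * (f₂ - f₁)).re ^ 2 + (s ^ 2 - dist f₁ f₂ ^ 2) * ‖x‖ ^ 2) -
        (x * (z - f₁) + x * (z - f₂)).re) / 2 := by
  rw [ellipseSupport]
  simp only [Complex.mul_re, Complex.add_re, Complex.add_im, Complex.sub_re, Complex.sub_im]
  ring

theorem re_le_ellipseSupport {f₁ f₂ z : ℂ} {s : ℝ} (hz : z ∈ ellipse f₁ f₂ s) (x : ℂ) :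
    (x * z).re ≤ ellipseSupport f₁ f₂ s x := by
  have h1 := radicand_sub_sq hz x
  have h2 := Complex.re_le_norm (x * (z - f₁) * (x * (z - f₂)))
  have h3 : (x * (z - f₁) + x * (z - f₂)).re ≤
      √((x * (f₂ - f₁)).re ^ 2 + (s ^ 2 - dist f₁ f₂ ^ 2) * ‖x‖ ^ 2) :=
    Real.le_sqrt_of_sq_le (by linarith)
  linarith [ellipseSupport_sub f₁ f₂ s x z]

/-- The reflection property: the normal bisects the angle between the focal rays, so after rotation
by x the product of z - f₁ and z - f₂ is real. -/
theorem im_mul_eq_zero_of_support {f₁ f₂ z : ℂ} {s : ℝ} (hs : dist f₁ f₂ < s)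
    (hz : z ∈ ellipse f₁ f₂ s) {x : ℂ} (hx : x ≠ 0)
    (h : ellipseSupport f₁ f₂ s x = (x * z).re) :
    (x * (z - f₁) * (x * (z - f₂))).im = 0 := by
  have h0 := ellipseSupport_radicand_pos hs hx
  have h1 := radicand_sub_sq hz x
  have h2 := ellipseSupport_sub f₁ f₂ s x z
  have h3 : (x * (z - f₁) + x * (z - f₂)).re =
      √((x * (f₂ - f₁)).re ^ 2 + (s ^ 2 - dist f₁ f₂ ^ 2) * ‖x‖ ^ 2) := by linarith
  rw [h3, Real.sq_sqrt h0.le] at h1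
  have h4 : (x * (z - f₁) * (x * (z - f₂))).re = ‖x * (z - f₁) * (x * (z - f₂))‖ := by linarith
  have h5 := Complex.normSq_apply (x * (z - f₁) * (x * (z - f₂)))
  rw [Complex.normSq_eq_norm_sq, ← h4] at h5
  nlinarith

/-- Strict convexity of the ellipse. -/
theorem re_lt_of_support {f₁ f₂ z z' : ℂ} {s : ℝ} (hs : dist f₁ f₂ < s)
    (hz : z ∈ ellipse f₁ f₂ s) (hz' : z' ∈ ellipse f₁ f₂ s) (hne : z' ≠ z) {x : ℂ} (hx : x ≠ 0)
    (h : ellipseSupport f₁ f₂ s x = (x * z).re) : (x * z').re < (x * z).re := by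
  refine lt_of_le_of_ne (h ▸ re_le_ellipseSupport hz' x) fun heq => hne ?_
  have h1 := im_mul_eq_zero_of_support hs hz hx h
  have h2 := im_mul_eq_zero_of_support hs hz' hx (h.trans heq.symm)
  have h3 := ellipseSupport_sub f₁ f₂ s x z
  have h4 : 0 < (x * (z - f₁) + x * (z - f₂)).re := by
    have := Real.sqrt_pos.mpr (ellipseSupport_radicand_pos hs hx)
    linarith
  have e1 : x * (z' - f₁) = x * (z - f₁) + x * (z' - z) := by ring
  have e2 : x * (z' - f₂) = x * (z - f₂) + x * (z' - z) := by ring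
  have e3 : (x * (z' - z)).re = 0 := by rw [mul_sub, Complex.sub_re]; linarith
  rw [e1, e2] at h2
  -- Two contact points of one tangent differ along it, so x(z' - z) is purely imaginary.
  -- Subtracting the two reality conditions leaves its length times a positive number.
  have h5 : (x * (z' - z)).im * (x * (z - f₁) + x * (z - f₂)).re = 0 := by
    simp only [Complex.mul_im (x * (z - f₁)), Complex.mul_im (x * (z - f₁) + x * (z' - z)),
      Complex.add_re, Complex.add_im, e3] at h1 h2 ⊢
    linarith
  have h6 : x * (z' - z) = 0 :=
    Complex.ext e3 ((mul_eq_zero.mp h5).resolve_right h4.ne')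
  exact sub_eq_zero.mp ((mul_eq_zero.mp h6).resolve_left hx)

/-- The bisecting directions are the square roots of the conjugate of (z - f₁)(z - f₂), which make
the rotated product positive; the sign is chosen to point outwards. -/
theorem exists_support {f₁ f₂ z : ℂ} {s : ℝ} (hs : dist f₁ f₂ < s)
    (hz : z ∈ ellipse f₁ f₂ s) :
    ∃ p : ℂ, p ≠ 0 ∧ ellipseSupport f₁ f₂ s p = (p * z).re := by
  have hz' : ‖z - f₁‖ + ‖z - f₂‖ = s := by simpa [ellipse, dist_eq_norm] using hz
  have hu : z - f₁ ≠ 0 := fun h => by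
    rw [sub_eq_zero] at h
    rw [← h, dist_eq_norm] at hs
    simp [← h] at hz'
    linarith
  have hv : z - f₂ ≠ 0 := fun h => by
    rw [sub_eq_zero] at h
    rw [← h, dist_comm, dist_eq_norm] at hs
    simp [← h] at hz'
    linarith
  have key : ∀ p : ℂ, p ^ 2 = (starRingEnd ℂ) ((z - f₁) * (z - f₂)) →
      0 ≤ (p * (z - f₁) + p * (z - f₂)).re → ellipseSupport f₁ f₂ s p = (p * z).re := by
    intro p hp hpos
    have h1 := radicand_sub_sq hz p
    have h2 : p * (z - f₁) * (p * (z - f₂)) = ((‖(z - f₁) * (z - f₂)‖ ^ 2 : ℝ) : ℂ) := by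
      rw [← Complex.normSq_eq_norm_sq, ← Complex.mul_conj, ← hp]; ring
    rw [h2, Complex.norm_real, Complex.ofReal_re, Real.norm_of_nonneg (by positivity), sub_self,
      mul_zero, sub_eq_zero] at h1
    have h3 := ellipseSupport_sub f₁ f₂ s p z
    rw [h1, Real.sqrt_sq hpos] at h3
    linarith
  obtain ⟨p, hp⟩ := IsAlgClosed.exists_pow_nat_eq ((starRingEnd ℂ) ((z - f₁) * (z - f₂)))
    (n := 2) (by norm_num)
  have hp0 : p ≠ 0 := by
    rintro rfl
    have : (starRingEnd ℂ) ((z - f₁) * (z - f₂)) = 0 := by rw [← hp]; simp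
    exact mul_ne_zero hu hv ((map_eq_zero _).mp this)
  rcases le_total 0 (p * (z - f₁) + p * (z - f₂)).re with h | h
  · exact ⟨p, hp0, key p hp h⟩
  · refine ⟨-p, neg_ne_zero.mpr hp0, key (-p) (by rw [neg_sq, hp]) ?_⟩
    simp only [neg_mul, Complex.add_re, Complex.neg_re] at h ⊢
    linarith

/-- The distances of the foci to a tangent line of the ellipse, scaled. -/
theorem ellipseSupport_sub_foci {f₁ f₂ : ℂ} {s : ℝ} (hs : dist f₁ f₂ < s) {x : ℂ} (hx : x ≠ 0) :
    0 < ellipseSupport f₁ f₂ s x - (x * f₁).re ∧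
    4 * ((ellipseSupport f₁ f₂ s x - (x * f₁).re) ^ 2 -
      (ellipseSupport f₁ f₂ s x - (x * f₁).re) * (x * (f₂ - f₁)).re) =
      (s ^ 2 - dist f₁ f₂ ^ 2) * ‖x‖ ^ 2 := by
  have h0 := axis_sq_sub_pos hs
  have hn := norm_pos_iff.mpr hx
  have h1 := Real.sq_sqrt (ellipseSupport_radicand_pos hs hx).le
  have h2 := Real.sqrt_nonneg ((x * (f₂ - f₁)).re ^ 2 + (s ^ 2 - dist f₁ f₂ ^ 2) * ‖x‖ ^ 2)
  have h3 : ellipseSupport f₁ f₂ s x - (x * f₁).re = ((x * (f₂ - f₁)).re +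
      √((x * (f₂ - f₁)).re ^ 2 + (s ^ 2 - dist f₁ f₂ ^ 2) * ‖x‖ ^ 2)) / 2 := by
    rw [ellipseSupport]
    simp only [mul_add, mul_sub, Complex.add_re, Complex.sub_re]
    ring
  rw [h3]
  set R := √((x * (f₂ - f₁)).re ^ 2 + (s ^ 2 - dist f₁ f₂ ^ 2) * ‖x‖ ^ 2)
  have h4 : 0 < (s ^ 2 - dist f₁ f₂ ^ 2) * ‖x‖ ^ 2 := by positivity
  constructor
  · have : |(x * (f₂ - f₁)).re| < R := abs_lt_of_sq_lt_sq (by linarith) h2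
    linarith [neg_abs_le (x * (f₂ - f₁)).re]
  · linarith

/-! ### The dual conic and the count of common tangents -/

/-- With x and x̄ treated as independent coordinates, `h` is the equation of the dual conic.
Projecting it from its point x = α = 0, that is, substituting α = bτx, makes the equation linear in
x and x̄ and gives the parametrisation. The two conclusions say that (X, Y, W) is (x, x̄, w) times
X/x. -/
theorem param_identities {x δ f b α w : ℂ} (hx : x ≠ 0) (hb : b ≠ 0)
    (h : b ^ 2 * (x * star x) = α ^ 2 - α * (x * δ + star x * star δ) / 2)
    (hw : w = α + (x * f + star x * star f) / 2) (τ X Y : ℂ) (hτ : τ = α / (b * x))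
    (hX : X = b + star δ * τ / 2) (hY : Y = b * τ ^ 2 - δ * τ / 2) :
    Y = X / x * star x ∧ b * τ * X + (X * f + Y * star f) / 2 = X / x * w := by
  have h1 : Y = X / x * star x := by
    rw [hX, hY, hτ]
    field_simp
    linear_combination (-2) * h
  refine ⟨h1, ?_⟩
  have h2 : b * τ * x = α := by rw [hτ]; field_simp
  rw [h1, hw, ← h2]
  field_simp

/-- Bézout's argument on the rational dual conic: a form of degree m with more than 2m zeros on it
vanishes on all of it, in particular at the isotropic tangent through f₁. Here b is the semi-minor
axis and α the scaled distance from f₁ to the tangent. -/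
theorem isCValue_of_tangents {n : ℕ} {A : Matrix (Fin n) (Fin n) ℂ} {c : Fin n → ℝ} {f₁ f₂ : ℂ}
    {s : ℝ} (hs : dist f₁ f₂ < s) {ι : Type*} [Fintype ι]
    (hι : 2 * cDegree A c < Fintype.card ι) (x : ι → ℂ) (hx : ∀ i, x i ≠ 0)
    (hray : ∀ i j, i ≠ j → ∀ r : ℝ, 0 < r → x i ≠ r * x j)
    (hroot : ∀ i, (cPolynomial (herm (x i) A) c).eval (ellipseSupport f₁ f₂ s (x i) : ℂ) = 0) :
    IsCValue A c f₁ := by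
  set δ := f₂ - f₁ with hδ
  obtain ⟨b, hb0, hb⟩ : ∃ b : ℝ, 0 < b ∧ 4 * b ^ 2 = s ^ 2 - dist f₁ f₂ ^ 2 := by
    have h0 := axis_sq_sub_pos hs
    refine ⟨√(s ^ 2 - dist f₁ f₂ ^ 2) / 2, by positivity, ?_⟩
    rw [div_pow, Real.sq_sqrt h0.le]; ring
  have hbc : (b : ℂ) ≠ 0 := by exact_mod_cast hb0.ne'
  set α : ι → ℝ := fun i => ellipseSupport f₁ f₂ s (x i) - (x i * f₁).re
  have hα0 : ∀ i, 0 < α i := fun i => (ellipseSupport_sub_foci hs (hx i)).1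
  have hre : ∀ y : ℂ, ((y.re : ℝ) : ℂ) = (y + star y) / 2 := fun y => by
    rw [Complex.re_eq_add_conj]; rfl
  have hα : ∀ i, (b : ℂ) ^ 2 * (x i * star (x i)) =
      (α i : ℂ) ^ 2 - α i * (x i * δ + star (x i) * star δ) / 2 := fun i => by
    have h1 := (ellipseSupport_sub_foci hs (hx i)).2
    rw [← hb] at h1
    have h2 : b ^ 2 * ‖x i‖ ^ 2 = α i ^ 2 - α i * (x i * δ).re := by
      simp only [α]; linarith
    have h3 := congrArg (fun r : ℝ => (r : ℂ)) h2
    push_cast at h3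
    rw [hre, star_mul'] at h3
    have h4 : x i * star (x i) = (‖x i‖ : ℂ) ^ 2 := Complex.mul_conj' _
    rw [h4, h3]; ring
  have hw : ∀ i, (ellipseSupport f₁ f₂ s (x i) : ℂ) =
      α i + (x i * f₁ + star (x i) * star f₁) / 2 := fun i => by
    rw [← star_mul', ← hre]; simp [α]
  set τ : ι → ℂ := fun i => α i / (b * x i)
  -- Equal parameters make x i / x j equal to the positive number α i / α j, contrary to `hray`.
  have hτ : Function.Injective τ := by
    intro i j hij
    by_contra hne
    refine hray i j hne (α i / α j) (div_pos (hα0 i) (hα0 j)) ?_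
    have h1 : (α j : ℂ) ≠ 0 := by exact_mod_cast (hα0 j).ne'
    have h2 : (α i : ℂ) / (b * x i) = α j / (b * x j) := hij
    have hi := hx i
    have hj := hx j
    field_simp at h2
    push_cast
    field_simp
    linear_combination -h2
  -- the homogeneous coordinates of the tangent lines as polynomials in the parameter
  let mk : ℂ[X] → ℂ[X] → Matrix (Fin n) (Fin n) ℂ[X] := fun p q =>
    (C (1 / 2 : ℂ)) • (p • A.map C + q • Aᴴ.map C)
  have hmk : ∀ p q t, (mk p q).map (eval t) =
      (1 / 2 : ℂ) • (p.eval t • A + q.eval t • Aᴴ) := fun p q t => by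
    ext i j; simp [mk]; ring
  let Xp : ℂ[X] := C (b : ℂ) + C (star δ / 2) * X
  let Yp : ℂ[X] := C (b : ℂ) * X ^ 2 - C (δ / 2) * X
  let Wp : ℂ[X] := C (b : ℂ) * X * Xp + C (f₁ / 2) * Xp + C (star f₁ / 2) * Yp
  -- The parametrisation near τ = ∞: each of these is the reversal of its counterpart in formal
  -- degree 2, which yields the degree bound 2m.
  let Xq : ℂ[X] := C (b : ℂ) * X ^ 2 + C (star δ / 2) * X
  let Yq : ℂ[X] := C (b : ℂ) - C (δ / 2) * X
  let Wq : ℂ[X] := C (b : ℂ) * (C (b : ℂ) * X + C (star δ / 2)) + C (f₁ / 2) * Xq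
    + C (star f₁ / 2) * Yq
  obtain ⟨P, hP⟩ := exists_polynomial_cPolynomial_eval c (mk Xp Yp) Wp
  obtain ⟨Q, hQ⟩ := exists_polynomial_cPolynomial_eval c (mk Xq Yq) Wq
  have hdeg : P.natDegree ≤ 2 * (rearrangements c).card := by
    refine natDegree_le_of_eval_inv (q := Q) fun t ht => ?_
    have ht2 : t ^ 2 ≠ 0 := pow_ne_zero 2 ht
    have e1 : Xp.eval t = t ^ 2 * Xq.eval t⁻¹ := by simp [Xp, Xq]; field_simp
    have e2 : Yp.eval t = t ^ 2 * Yq.eval t⁻¹ := by simp [Yp, Yq]; field_simp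
    have e3 : Wp.eval t = t ^ 2 * Wq.eval t⁻¹ := by
      simp [Wp, Wq, Xp, Yp, Xq, Yq]; field_simp
    rw [hP, hQ, hmk, hmk, pow_mul, ← cPolynomial_eval_smul _ _ ht2, ← e3, e1, e2]
    congr 2
    rw [smul_comm, smul_add (t ^ 2), smul_smul (t ^ 2), smul_smul (t ^ 2)]
  have hroots : ∀ i, P.eval (τ i) = 0 := fun i => by
    obtain ⟨h1, h2⟩ := param_identities (hx i) hbc (hα i) (hw i) (τ i) (Xp.eval (τ i))
      (Yp.eval (τ i)) rfl (by simp [Xp]; ring) (by simp [Yp]; ring)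
    -- If X vanished then so would Y, and eliminating τ would give 4b² + |δ|² = 0.
    have hX0 : Xp.eval (τ i) ≠ 0 := by
      intro h0
      have e1 : (b : ℂ) + star δ * τ i / 2 = 0 := by rw [← h0]; simp [Xp]; ring
      have e2 : (b : ℂ) * τ i ^ 2 - δ * τ i / 2 = 0 := by
        rw [h0] at h1
        simp only [zero_div, zero_mul] at h1
        rw [← h1]; simp [Yp]; ring
      have ha : (α i : ℂ) ≠ 0 := by exact_mod_cast (hα0 i).ne'
      have hτ0 : τ i ≠ 0 := div_ne_zero ha (mul_ne_zero hbc (hx i))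
      have e3 : (b : ℂ) * τ i - δ / 2 = 0 := by
        apply mul_right_cancel₀ hτ0
        linear_combination e2
      have e4 : (4 : ℂ) * b ^ 2 + δ * star δ = 0 := by
        linear_combination 4 * b * e1 - 2 * star δ * e3
      have e5 : δ * star δ = (‖δ‖ : ℂ) ^ 2 := Complex.mul_conj' _
      rw [e5] at e4
      have e6 : 4 * b ^ 2 + ‖δ‖ ^ 2 = 0 := by exact_mod_cast e4
      nlinarith [sq_nonneg ‖δ‖, pow_pos hb0 2]
    have hl : Xp.eval (τ i) / x i ≠ 0 := div_ne_zero hX0 (hx i)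
    have e1 : Wp.eval (τ i) = Xp.eval (τ i) / x i * ellipseSupport f₁ f₂ s (x i) := by
      rw [← h2]; simp [Wp]; ring
    rw [hP, hmk, e1, h1]
    have e2 : (1 / 2 : ℂ) • (Xp.eval (τ i) • A + (Xp.eval (τ i) / x i * star (x i)) • Aᴴ) =
        (Xp.eval (τ i) / x i) • herm (x i) A := by
      rw [herm, smul_comm (Xp.eval (τ i) / x i), smul_add (Xp.eval (τ i) / x i), smul_smul,
        smul_smul, div_mul_cancel₀ _ (hx i)]
    rw [e2, cPolynomial_eval_smul _ _ hl, hroot i, mul_zero]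
  have hP0 : P = 0 := by
    classical
    refine Polynomial.eq_zero_of_natDegree_lt_card_of_eval_eq_zero P hτ hroots ?_
    rw [cDegree_eq_card] at hι
    omega
  -- At τ = 0 the coordinates are X = b, Y = 0, W = b f₁ / 2, so the matrix is (b/2) A and the
  -- factor b/2 can be taken out.
  have h0 := hP 0
  rw [hP0, hmk] at h0
  have e1 : Xp.eval 0 = b := by simp [Xp]
  have e2 : Yp.eval 0 = 0 := by simp [Yp]
  have e3 : Wp.eval 0 = (b / 2 : ℂ) * f₁ := by simp [Wp, Xp, Yp]; ring
  have e4 : (1 / 2 : ℂ) • ((b : ℂ) • A + (0 : ℂ) • Aᴴ) = (b / 2 : ℂ) • A := by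
    rw [zero_smul, add_zero, smul_smul]; congr 1; ring
  have hb2 : (b / 2 : ℂ) ≠ 0 := div_ne_zero hbc two_ne_zero
  rw [e1, e2, e3, e4, cPolynomial_eval_smul _ _ hb2, eval_zero, eq_comm] at h0
  exact isCValue_of_cPolynomial_eval ((mul_eq_zero.mp h0).resolve_left (pow_ne_zero _ hb2))


/-! ### The support function of W(A;c) and its contact with the ellipse -/

/-- `x ↦ ∑ c_j λ_j((x A + x̄ A*) / 2)`, the function whose half-planes cut out `W(A;c)`. -/
noncomputable def weightedSupport {n : ℕ} (A : Matrix (Fin n) (Fin n) ℂ) (c : Fin n → ℝ)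
    (x : ℂ) : ℝ :=
  ∑ j, c j * hermEig (herm_isHermitian x A) j

theorem continuous_herm {n : ℕ} (A : Matrix (Fin n) (Fin n) ℂ) :
    Continuous fun x : ℂ => herm x A := by
  unfold herm
  fun_prop

theorem continuous_weightedSupport {n : ℕ} (A : Matrix (Fin n) (Fin n) ℂ) (c : Fin n → ℝ) :
    Continuous (weightedSupport A c) :=
  continuous_finsetSum _ fun j _ => continuous_const.mul
    (continuous_hermEig (fun x => herm_isHermitian x A) (continuous_herm A) j)

theorem herm_real_mul {n : ℕ} (A : Matrix (Fin n) (Fin n) ℂ) (r : ℝ) (x : ℂ) :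
    herm (r * x) A = (r : ℂ) • herm x A := by
  unfold herm
  have : star ((r : ℂ) * x) = r * star x := by simp
  rw [this, smul_comm (r : ℂ), smul_add (r : ℂ), smul_smul, smul_smul]

theorem weightedSupport_real_mul {n : ℕ} (A : Matrix (Fin n) (Fin n) ℂ) (c : Fin n → ℝ) {r : ℝ}
    (hr : 0 < r) (x : ℂ) : weightedSupport A c (r * x) = r * weightedSupport A c x := by
  rw [weightedSupport, weightedSupport, Finset.mul_sum]
  refine Finset.sum_congr rfl fun j _ => ?_
  rw [hermEig_smul (herm_isHermitian x A) _ hr (herm_real_mul A r x) j]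
  ring

theorem hermEig_congr {n : ℕ} {H K : Matrix (Fin n) (Fin n) ℂ} (h : H = K) (hH : H.IsHermitian)
    (hK : K.IsHermitian) (j : Fin n) : hermEig hH j = hermEig hK j := by
  subst h; rfl

theorem mem_weightedRange_iff {n : ℕ} {A : Matrix (Fin n) (Fin n) ℂ} {c : Fin n → ℝ} {v : ℂ} :
    v ∈ weightedRange A c ↔ ∀ x ∈ Metric.sphere (0 : ℂ) 1, (x * v).re ≤ weightedSupport A c x := by
  have key : ∀ θ : ℝ, ∑ j, c j * hermEig (rotHerm_isHermitian A θ) j =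
      weightedSupport A c (Complex.exp (Complex.I * θ)) := fun θ =>
    Finset.sum_congr rfl fun j _ => by rw [hermEig_congr (rotHerm_eq_herm A θ)]
  simp only [weightedRange, Set.mem_iInter, Set.mem_ofPred_eq, key]
  constructor
  · intro h x hx
    have h1 := h x.arg
    have h2 : Complex.exp (Complex.I * x.arg) = x := by
      have := Complex.norm_mul_exp_arg_mul_I x
      rw [mem_sphere_zero_iff_norm.mp hx] at this
      rw [mul_comm]; simpa using this
    rwa [h2] at h1
  · intro h θ
    refine h _ ?_
    rw [mem_sphere_zero_iff_norm, mul_comm]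
    exact Complex.norm_exp_ofReal_mul_I θ

theorem re_le_weightedSupport {n : ℕ} {A : Matrix (Fin n) (Fin n) ℂ} {c : Fin n → ℝ} {v : ℂ}
    (hv : v ∈ weightedRange A c) {x : ℂ} (hx : x ≠ 0) : (x * v).re ≤ weightedSupport A c x := by
  have hn := norm_pos_iff.mpr hx
  have h1 := mem_weightedRange_iff.mp hv (((‖x‖⁻¹ : ℝ) : ℂ) * x) (by simp [hn.ne'])
  rw [weightedSupport_real_mul A c (by positivity), mul_assoc, Complex.re_ofReal_mul] at h1
  exact le_of_mul_le_mul_left h1 (by positivity)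

theorem isClosed_weightedRange {n : ℕ} (A : Matrix (Fin n) (Fin n) ℂ) (c : Fin n → ℝ) :
    IsClosed (weightedRange A c) :=
  isClosed_iInter fun _ => isClosed_le (by fun_prop) continuous_const

/-- If on a compact set of parameters strict inequalities hold, they persist nearby. -/
theorem isOpen_forall_lt {X Y : Type*} [TopologicalSpace X] [TopologicalSpace Y] {K : Set Y}
    (hK : IsCompact K) {f g : X × Y → ℝ} (hf : Continuous f) (hg : Continuous g) :
    IsOpen {a | ∀ y ∈ K, f (a, y) < g (a, y)} := by
  rw [isOpen_iff_mem_nhds]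
  intro a ha
  refine hK.eventually_forall_of_forall_eventually fun y hy => ?_
  exact (isOpen_lt hf hg).mem_nhds (ha y hy)

/-- The points of `W(A;c)` on one of the defining lines. -/
def contactSet {n : ℕ} (A : Matrix (Fin n) (Fin n) ℂ) (c : Fin n → ℝ) : Set ℂ :=
  {v ∈ weightedRange A c | ∃ q : ℂ, q ≠ 0 ∧ weightedSupport A c q = (q * v).re}

theorem isOpen_strict_weightedRange {n : ℕ} (A : Matrix (Fin n) (Fin n) ℂ) (c : Fin n → ℝ) :
    IsOpen {v : ℂ | ∀ x ∈ Metric.sphere (0 : ℂ) 1, (x * v).re < weightedSupport A c x} :=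
  isOpen_forall_lt (isCompact_sphere 0 1)
    (f := fun p : ℂ × ℂ => (p.2 * p.1).re) (g := fun p : ℂ × ℂ => weightedSupport A c p.2)
    (by fun_prop) ((continuous_weightedSupport A c).comp continuous_snd)

/-- A set between the open and the closed intersection of half-planes has its frontier in the
contact set. -/
theorem frontier_subset_contactSet {n : ℕ} {A : Matrix (Fin n) (Fin n) ℂ} {c : Fin n → ℝ}
    {L : Set ℂ} (hL : L ⊆ weightedRange A c)
    (hL' : {v : ℂ | ∀ x ∈ Metric.sphere (0 : ℂ) 1, (x * v).re < weightedSupport A c x} ⊆ L) :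
    frontier L ⊆ contactSet A c := by
  intro v hv
  have hvW : v ∈ weightedRange A c :=
    closure_minimal hL (isClosed_weightedRange A c) (frontier_subset_closure hv)
  refine ⟨hvW, ?_⟩
  have h1 : v ∉ {v : ℂ | ∀ x ∈ Metric.sphere (0 : ℂ) 1, (x * v).re < weightedSupport A c x} :=
    fun h => hv.2 (interior_maximal hL' (isOpen_strict_weightedRange A c) h)
  simp only [Set.mem_ofPred_eq, not_forall, not_lt] at h1
  obtain ⟨x, hx, hxv⟩ := h1
  exact ⟨x, ne_zero_of_mem_unit_sphere ⟨x, hx⟩,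
    le_antisymm hxv (mem_weightedRange_iff.mp hvW x hx)⟩

theorem frontier_weightedRange_subset {n : ℕ} (A : Matrix (Fin n) (Fin n) ℂ) (c : Fin n → ℝ) :
    frontier (weightedRange A c) ⊆ contactSet A c :=
  frontier_subset_contactSet subset_rfl fun _ hv =>
    mem_weightedRange_iff.mpr fun x hx => (hv x hx).le

/-- At a point of the ellipse in the contact set, a common tangent direction of `W(A;c)` and the
ellipse lies between the normal directions there. -/
theorem exists_common_tangent {n : ℕ} {A : Matrix (Fin n) (Fin n) ℂ} {c : Fin n → ℝ}
    {f₁ f₂ : ℂ} {s : ℝ} (hs : dist f₁ f₂ < s) {T : Set ℂ}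
    (hT : T ⊆ contactSet A c ∩ ellipse f₁ f₂ s) {z : ℂ} (hz : z ∈ T) :
    ∃ x : ℂ, weightedSupport A c x = ellipseSupport f₁ f₂ s x ∧
      ∀ z' ∈ T, z' ≠ z → (x * z').re < (x * z).re := by
  obtain ⟨⟨hzW, q, hq0, hq⟩, hzE⟩ := hT hz
  obtain ⟨p, hp0, hp⟩ := exists_support hs hzE
  have hpz : ∀ z' ∈ T, z' ≠ z → (p * z').re < (p * z).re := fun z' hz' hne =>
    re_lt_of_support hs hzE (hT hz').2 hne hp0 hp
  by_cases hqE : ellipseSupport f₁ f₂ s q = (q * z).re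
  · exact ⟨q, hq.trans hqE.symm, fun z' hz' hne =>
      re_lt_of_support hs hzE (hT hz').2 hne hq0 hqE⟩
  have hq1 : weightedSupport A c q - ellipseSupport f₁ f₂ s q < 0 := by
    have := lt_of_le_of_ne (re_le_ellipseSupport hzE q) (Ne.symm hqE)
    linarith
  have hp1 : 0 ≤ weightedSupport A c p - ellipseSupport f₁ f₂ s p := by
    have := re_le_weightedSupport hzW hp0
    linarith
  -- The difference of the support functions is nonnegative at p and negative at q, so it vanishes
  -- at some t < 1. As z maximises Re(q ·) on T and is the only maximiser of Re(p ·), the weight 1 -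
  -- t > 0 keeps the inequality strict.
  let γ : ℝ → ℂ := fun t => ((1 - t : ℝ) : ℂ) * p + (t : ℂ) * q
  have hγ : Continuous γ := by fun_prop
  have hG : Continuous fun t => weightedSupport A c (γ t) - ellipseSupport f₁ f₂ s (γ t) :=
    ((continuous_weightedSupport A c).comp hγ).sub ((continuous_ellipseSupport f₁ f₂ s).comp hγ)
  have hγ0 : γ 0 = p := by simp [γ]
  have hγ1 : γ 1 = q := by simp [γ]
  obtain ⟨t, ⟨ht0, ht1⟩, ht⟩ := intermediate_value_Icc' zero_le_one hG.continuousOn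
    (show (0 : ℝ) ∈ _ from ⟨by simp only [hγ1]; exact hq1.le, by simp only [hγ0]; exact hp1⟩)
  have ht1' : t < 1 := lt_of_le_of_ne ht1 fun h => by
    simp only [h, hγ1] at ht
    linarith
  refine ⟨γ t, sub_eq_zero.mp ht, fun z' hz' hne => ?_⟩
  have h1 := hpz z' hz' hne
  have h2 := re_le_weightedSupport (hT hz').1.1 hq0
  rw [hq] at h2
  have h3 : ∀ y, (γ t * y).re = (1 - t) * (p * y).re + t * (q * y).re := fun y => by
    simp only [γ, add_mul, Complex.add_re, mul_assoc, Complex.re_ofReal_mul]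
  rw [h3, h3]
  have h4 := mul_lt_mul_of_pos_left h1 (sub_pos.mpr ht1')
  have h5 := mul_le_mul_of_nonneg_left h2 ht0
  linarith

/-- Each z in S is the only maximiser of Re(x_z ·) on S, so no two of the directions x_z are
positive multiples of each other. -/
theorem isCValue_of_contactSet {n : ℕ} {A : Matrix (Fin n) (Fin n) ℂ} {c : Fin n → ℝ}
    {f₁ f₂ : ℂ} {s : ℝ} (hs : dist f₁ f₂ < s) {S : Finset ℂ} (hcard : S.card = 2 * cDegree A c + 1)
    (hS : (S : Set ℂ) ⊆ contactSet A c ∩ ellipse f₁ f₂ s) : IsCValue A c f₁ := by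
  choose x hx1 hx2 using fun z : S => exists_common_tangent hs hS z.2
  have hpos : 0 < cDegree A c := by
    rw [cDegree_eq_card]
    exact Finset.card_pos.mpr ⟨c, mem_rearrangements.mpr ⟨1, rfl⟩⟩
  refine isCValue_of_tangents hs (ι := S) (by simp; omega) x ?_ ?_ ?_
  -- A second point exists because the degree is positive; the strict inequality between the two
  -- points rules out x = 0.
  · intro z hz
    obtain ⟨z', hz', hne⟩ := Finset.exists_mem_ne (by omega : 1 < S.card) (z : ℂ)
    have := hx2 z z' hz' hne
    simp [hz] at this
  · intro z z' hne r hr h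
    have h1 := hx2 z z' z'.2 (fun h => hne (Subtype.ext h.symm))
    have h2 := hx2 z' z z.2 (fun h => hne (Subtype.ext h))
    rw [h, mul_assoc, mul_assoc, Complex.re_ofReal_mul, Complex.re_ofReal_mul] at h1
    have := lt_of_mul_lt_mul_left h1 hr.le
    linarith
  · intro z
    rw [← hx1]
    exact cPolynomial_eval_hermEig _ c

theorem isCValue_foci_of_contactSet {n : ℕ} {A : Matrix (Fin n) (Fin n) ℂ} {c : Fin n → ℝ}
    {f₁ f₂ : ℂ} {s : ℝ} (hs : dist f₁ f₂ < s) {S : Finset ℂ} (hcard : S.card = 2 * cDegree A c + 1)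
    (hS : (S : Set ℂ) ⊆ contactSet A c ∩ ellipse f₁ f₂ s) : IsCValue A c f₁ ∧ IsCValue A c f₂ := by
  have h : ellipse f₁ f₂ s = ellipse f₂ f₁ s := by
    ext z; simp [ellipse, add_comm]
  exact ⟨isCValue_of_contactSet hs hcard hS,
    isCValue_of_contactSet (by rwa [dist_comm]) hcard (h ▸ hS)⟩


/-! ### Inverse interlacing for real diagonal matrices -/

/-- The sum is the coefficient of degree b in the Lagrange interpolation of g at b + 1 nodes. -/
theorem sum_eval_div_prod_succAbove {b : ℕ} {ν : Fin (b + 1) → ℝ} (hν : Function.Injective ν)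
    {g : ℝ[X]} (hg : g.degree < b) :
    ∑ i, g.eval (ν i) / ∏ j, (ν i - ν (i.succAbove j)) = 0 := by
  have h := Lagrange.coeff_eq_sum (s := Finset.univ) (v := ν) hν.injOn (P := g)
    (hg.trans (by simp; exact_mod_cast Nat.lt_succ_self b))
  rw [Finset.card_univ, Fintype.card_fin, Nat.add_sub_cancel,
    coeff_eq_zero_of_degree_lt hg] at h
  rw [h]
  refine Finset.sum_congr rfl fun i _ => ?_
  congr 1
  have : Finset.univ.erase i = Finset.univ.image i.succAbove := by
    rw [Fin.image_succAbove_univ, Finset.compl_singleton]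
  rw [this, Finset.prod_image fun x _ y _ hxy => Fin.succAbove_right_injective hxy]

/-- Converse of Cauchy interlacing for compressions to a hyperplane. -/
theorem exists_isometry_of_interlacing_succ {b : ℕ} (ν : Fin (b + 1) → ℝ) (ν' : Fin b → ℝ)
    (h1 : ∀ j, ν j.castSucc < ν' j) (h2 : ∀ j, ν' j < ν j.succ) :
    ∃ V : Matrix (Fin (b + 1)) (Fin b) ℝ, Vᵀ * V = 1 ∧ Vᵀ * diagonal ν * V = diagonal ν' := by
  have hν : StrictMono ν := Fin.strictMono_iff_lt_succ.mpr fun i => (h1 i).trans (h2 i)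
  have hinj : Function.Injective ν' := by
    refine StrictMono.injective fun i j hij => (h2 i).trans_le (le_trans ?_ (h1 j).le)
    exact hν.monotone (Fin.le_def.mpr (by simpa using hij))
  have hlow : ∀ i (j : Fin b), j.castSucc < i → ν' j < ν i := fun i j hij =>
    (h2 j).trans_le (hν.monotone (Fin.le_def.mpr (by simpa [Fin.lt_def] using hij)))
  have hhigh : ∀ i (j : Fin b), i ≤ j.castSucc → ν i < ν' j := fun i j hij =>
    (hν.monotone hij).trans_lt (h1 j)
  have hne : ∀ i j, ν i - ν' j ≠ 0 := fun i j => by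
    rcases lt_or_ge j.castSucc i with h | h
    · exact (sub_pos.mpr (hlow i j h)).ne'
    · exact (sub_neg.mpr (hhigh i j h)).ne
  -- The residues of ∏(x - ν'_j) / ∏(x - ν_i); interlacing makes them positive. They serve as
  -- squared coordinates of a normal vector √u of the hyperplane.
  let u : Fin (b + 1) → ℝ := fun i => ∏ j, (ν i - ν' j) / (ν i - ν (i.succAbove j))
  have hu : ∀ i, 0 < u i := fun i => Finset.prod_pos fun j _ => by
    rcases lt_or_ge j.castSucc i with h | h
    · rw [Fin.succAbove_of_castSucc_lt _ _ h]
      exact div_pos (sub_pos.mpr (hlow i j h)) (sub_pos.mpr (hν h))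
    · rw [Fin.succAbove_of_le_castSucc _ _ h]
      refine div_pos_of_neg_of_neg (sub_neg.mpr (hhigh i j h)) (sub_neg.mpr (hν ?_))
      exact Fin.lt_def.mpr (by simpa [Fin.le_def, Nat.lt_succ_iff] using h)
  have hsum : ∀ l, ∑ i, u i / (ν i - ν' l) = 0 := fun l => by
    let g : ℝ[X] := ∏ m ∈ Finset.univ.erase l, (X - C (ν' m))
    have hg : g.degree < b := by
      have hm : g.Monic := monic_prod_of_monic _ _ fun m _ => monic_X_sub_C _
      rw [degree_eq_natDegree hm.ne_zero]
      have : g.natDegree = b - 1 := by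
        rw [natDegree_prod_of_monic _ _ fun m _ => monic_X_sub_C _]
        simp
      rw [this]
      have := l.2
      exact_mod_cast (by omega : b - 1 < b)
    rw [← sum_eval_div_prod_succAbove hν.injective hg]
    refine Finset.sum_congr rfl fun i _ => ?_
    have h3 := Finset.mul_prod_erase Finset.univ (fun j => ν i - ν' j) (Finset.mem_univ l)
    have h4 : g.eval (ν i) = ∏ m ∈ Finset.univ.erase l, (ν i - ν' m) := by
      simp [g, eval_prod]
    simp only [u]
    rw [Finset.prod_div_distrib, ← h3, h4, div_right_comm, mul_div_cancel_left₀ _ (hne i l)]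
  let R : Fin b → ℝ := fun j => ∑ i, u i / (ν i - ν' j) ^ 2
  have hR : ∀ j, 0 < R j := fun j => Finset.sum_pos (fun i _ => by
    have := hu i
    have := hne i j
    positivity) Finset.univ_nonempty
  -- Column j is the normalised vector (D - ν'_j)⁻¹√u with D = diag ν; `hsum` says that it is
  -- orthogonal to √u.
  let V : Matrix (Fin (b + 1)) (Fin b) ℝ := of fun i j => √(u i) / (ν i - ν' j) / √(R j)
  have hV : ∀ i j l, V i j * V i l =
      u i / ((ν i - ν' j) * (ν i - ν' l)) / (√(R j) * √(R l)) := fun i j l => by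
    simp only [V, of_apply]
    rw [div_mul_div_comm, div_mul_div_comm, Real.mul_self_sqrt (hu i).le]
  -- (D - ν'_j) sends column j to a multiple of √u, which is orthogonal to column l.
  have hG : ∀ j l, ∑ i, ν i * (V i j * V i l) = ν' j * ∑ i, V i j * V i l := fun j l => by
    rw [← sub_eq_zero, Finset.mul_sum, ← Finset.sum_sub_distrib,
      ← zero_div (√(R j) * √(R l)), ← hsum l, Finset.sum_div]
    refine Finset.sum_congr rfl fun i _ => ?_
    rw [hV]
    have := hne i j
    have := hne i l
    field_simp
  have hgram : Vᵀ * V = 1 := by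
    ext j l
    rw [mul_apply, one_apply]
    simp only [transpose_apply]
    split_ifs with hjl
    · subst hjl
      simp only [hV, ← Finset.sum_div, ← sq]
      rw [Real.sq_sqrt (hR j).le, div_self (hR j).ne']
    -- Exchanging j and l gives orthogonality, as for eigenvectors of distinct eigenvalues.
    · have e1 := hG j l
      have e2 := hG l j
      have e3 : ∑ i, ν i * (V i l * V i j) = ∑ i, ν i * (V i j * V i l) :=
        Finset.sum_congr rfl fun i _ => by ring
      have e4 : ∑ i, V i l * V i j = ∑ i, V i j * V i l :=
        Finset.sum_congr rfl fun i _ => by ring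
      rw [e3, e4, e1] at e2
      have e5 : (ν' j - ν' l) * ∑ i, V i j * V i l = 0 := by rw [sub_mul, e2, sub_self]
      exact (mul_eq_zero.mp e5).resolve_left (sub_ne_zero.mpr (hinj.ne hjl))
  refine ⟨V, hgram, ?_⟩
  ext j l
  have e1 : (Vᵀ * diagonal ν * V) j l = ∑ i, ν i * (V i j * V i l) := by
    rw [mul_apply]
    refine Finset.sum_congr rfl fun i _ => ?_
    rw [mul_diagonal, transpose_apply]; ring
  have e2 := congrFun (congrFun hgram j) l
  rw [mul_apply] at e2
  simp only [transpose_apply] at e2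
  rw [e1, hG, e2, one_apply, diagonal_apply]
  split_ifs <;> simp

/-- The theorem of Fan and Pall: interlacing sequences are the spectra of a real diagonal matrix
and of a compression of it. -/
theorem exists_isometry_of_interlacing {a : ℕ} {π : Fin a → ℝ} (hπ : StrictMono π) :
    ∀ (g : ℕ) {ν : Fin (a + g) → ℝ}, StrictMono ν →
      (∀ i, ν (Fin.castAdd g i) < π i) → (∀ i, π i < ν (Fin.addNat i g)) →
      ∃ V : Matrix (Fin (a + g)) (Fin a) ℝ, Vᵀ * V = 1 ∧ Vᵀ * diagonal ν * V = diagonal π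
  | 0, ν, hν, h1, h2 => by
    -- With g = 0 both bounds on π i involve the same ν i, so a must be 0.
    have : IsEmpty (Fin a) := ⟨fun i => ((h1 i).trans (h2 i)).ne rfl⟩
    exact ⟨0, Subsingleton.elim _ _, Subsingleton.elim _ _⟩
  | 1, ν, hν, h1, h2 => exists_isometry_of_interlacing_succ ν π h1 h2
  | g + 2, ν, hν, h1, h2 => by
    -- An intermediate sequence one term shorter: it strictly interlaces ν and still satisfies the
    -- hypotheses relative to π. Each term lies between max(ν_i, π_{i-g-1}) and min(ν_{i+1}, π_i),
    -- an entry of π being omitted when its index is out of range.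
    have hex : ∀ i : Fin (a + (g + 1)), ∃ y, ν (Fin.castSucc i) < y ∧ y < ν (Fin.succ i) ∧
        (∀ l : Fin a, Fin.castAdd (g + 1) l = i → y < π l) ∧
        (∀ l : Fin a, Fin.addNat l (g + 1) = i → π l < y) := by
      intro i
      have h0 : ν (Fin.castSucc i) < ν (Fin.succ i) := hν Fin.castSucc_lt_succ
      have hup : ∃ p, ν (Fin.castSucc i) < p ∧ p ≤ ν (Fin.succ i) ∧
          (∀ l : Fin a, Fin.castAdd (g + 1) l = i → p ≤ π l) ∧
          (∀ l : Fin a, Fin.addNat l (g + 1) = i → π l < p) := by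
        by_cases hi : (i : ℕ) < a
        · have e : Fin.castAdd (g + 2) (⟨i, hi⟩ : Fin a) = Fin.castSucc i := rfl
          refine ⟨min (ν (Fin.succ i)) (π ⟨i, hi⟩), lt_min h0 (e ▸ h1 ⟨i, hi⟩), min_le_left _ _,
            fun l hl => ?_, fun l hl => lt_min ?_ ?_⟩
          · have : l = ⟨i, hi⟩ := Fin.ext (by simp [← hl])
            rw [this]; exact min_le_right _ _
          · rw [← hl]; exact h2 l
          · refine hπ (Fin.lt_def.mpr ?_)
            have := congrArg Fin.val hl
            simp at this ⊢
            omega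
        · refine ⟨ν (Fin.succ i), h0, le_rfl, fun l hl => absurd l.2 ?_, fun l hl => ?_⟩
          · have := congrArg Fin.val hl
            simp at this
            omega
          · rw [← hl]; exact h2 l
      obtain ⟨p, hp0, hp1, hp2, hp3⟩ := hup
      by_cases hi : ∃ l : Fin a, Fin.addNat l (g + 1) = i
      · obtain ⟨l, hl⟩ := hi
        obtain ⟨y, hy1, hy2⟩ := exists_between (max_lt hp0 (hp3 l hl))
        refine ⟨y, (le_max_left _ _).trans_lt hy1, hy2.trans_le hp1,
          fun m hm => hy2.trans_le (hp2 m hm), fun m hm => ?_⟩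
        have : m = l := by
          have := congrArg Fin.val (hm.trans hl.symm)
          simp at this
          exact Fin.ext this
        rw [this]; exact (le_max_right _ _).trans_lt hy1
      · obtain ⟨y, hy1, hy2⟩ := exists_between hp0
        exact ⟨y, hy1, hy2.trans_le hp1, fun m hm => hy2.trans_le (hp2 m hm),
          fun m hm => absurd ⟨m, hm⟩ hi⟩
    choose ν' hν1 hν2 hν3 hν4 using hex
    have hmono : StrictMono ν' := fun i j hij =>
      (hν2 i).trans_le ((hν.monotone (Fin.le_def.mpr (by simpa using hij))).trans (hν1 j).le)
    obtain ⟨V, hV1, hV2⟩ := exists_isometry_of_interlacing_succ ν ν' hν1 hν2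
    obtain ⟨U, hU1, hU2⟩ := exists_isometry_of_interlacing hπ (g + 1) hmono
      (fun l => hν3 _ l rfl) (fun l => hν4 _ l rfl)
    refine ⟨V * U, ?_, ?_⟩
    · rw [transpose_mul, Matrix.mul_assoc, ← Matrix.mul_assoc Vᵀ, hV1, Matrix.one_mul, hU1]
    · rw [transpose_mul, ← hU2, ← hV2]
      simp only [Matrix.mul_assoc]


/-! ### Common isotropic subspaces of two real diagonal forms -/

theorem exists_strictMono_enumeration {κ : Type*} [Fintype κ] {t : κ → ℝ}
    (ht : Function.Injective t) {a : ℕ} (ha : Fintype.card κ = a) :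
    ∃ e : Fin a ≃ κ, StrictMono (t ∘ e) := by
  let _ : LinearOrder κ := LinearOrder.lift' t ht
  refine ⟨(monoEquivOfFin κ ha).toEquiv, fun i j hij => ?_⟩
  exact (monoEquivOfFin κ ha).strictMono hij

theorem exists_gt_forall_lt {ι : Type*} [Finite ι] (t : ι → ℝ) (x : ℝ) :
    ∃ τ, x < τ ∧ ∀ j, x < t j → τ < t j := by
  have h : ∀ᶠ τ in nhdsWithin x (Set.Ioi x), ∀ j, x < t j → τ < t j := by
    refine Filter.eventually_all.mpr fun j => ?_
    by_cases hj : x < t j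
    · filter_upwards [nhdsWithin_le_nhds (eventually_lt_nhds hj)] with τ hτ _ using hτ
    · exact Filter.Eventually.of_forall fun τ h => absurd h hj
  obtain ⟨τ, h1, h2⟩ := (h.and (self_mem_nhdsWithin (a := x) (s := Set.Ioi x))).exists
  exact ⟨τ, h2, h1⟩

theorem exists_lt_forall_lt {ι : Type*} [Finite ι] (t : ι → ℝ) (x : ℝ) :
    ∃ τ, τ < x ∧ ∀ j, t j < x → t j < τ := by
  obtain ⟨τ, h1, h2⟩ := exists_gt_forall_lt (fun j => -t j) (-x)
  exact ⟨-τ, by linarith, fun j hj => by have := h2 j (neg_lt_neg hj); linarith⟩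

/-- Real diagonal forms with simple pencil, with as few positive entries as possible in the first
form, have a common isotropic subspace of dimension the number of positive entries. -/
theorem exists_isotropic_of_minimal {ι : Type*} [Fintype ι] (h t : ι → ℝ) (hh : ∀ i, h i ≠ 0)
    (ht : Function.Injective t)
    (hlow : ∀ τ : ℝ, (∀ i, t i ≠ τ) → (Finset.univ.filter fun i => 0 < h i ∧ t i < τ).card ≤
      (Finset.univ.filter fun i => ¬ 0 < h i ∧ t i < τ).card)
    (hhigh : ∀ τ : ℝ, (∀ i, t i ≠ τ) → (Finset.univ.filter fun i => 0 < h i ∧ τ < t i).card ≤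
      (Finset.univ.filter fun i => ¬ 0 < h i ∧ τ < t i).card) :
    ∃ X : Matrix ι (Fin (Finset.univ.filter fun i => 0 < h i).card) ℝ,
      (∀ y : Fin (Finset.univ.filter fun i => 0 < h i).card → ℂ,
        (∀ i, ∑ l, (X i l : ℂ) * y l = 0) → y = 0) ∧
      (∀ l m, ∑ i, h i * (X i l * X i m) = 0) ∧
      (∀ l m, ∑ i, t i * h i * (X i l * X i m) = 0) := by
  classical
  set a := (Finset.univ.filter fun i => 0 < h i).card with ha
  set b := (Finset.univ.filter fun i => ¬ 0 < h i).card with hb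
  -- A threshold τ above all ratios turns `hlow` into a comparison of the total counts.
  have hab : a ≤ b := by
    obtain ⟨τ, hτ⟩ := (Filter.eventually_all.mpr fun i =>
      Filter.eventually_gt_atTop (t i)).exists
    have := hlow τ fun i => (hτ i).ne
    simpa only [hτ, and_true] using this
  obtain ⟨g, hg⟩ := Nat.exists_eq_add_of_le hab
  obtain ⟨p, hp⟩ := exists_strictMono_enumeration (κ := {i // 0 < h i})
    (t := fun i => t i) (ht.comp Subtype.val_injective) (a := a) (Fintype.card_subtype _)
  obtain ⟨q, hq⟩ := exists_strictMono_enumeration (κ := {i // ¬ 0 < h i})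
    (t := fun i => t i) (ht.comp Subtype.val_injective) (a := a + g)
    ((Fintype.card_subtype _).trans hg)
  have hpq : ∀ i j, t (p i) ≠ t (q j) := fun i j hij => (q j).2 (ht hij ▸ (p i).2)
  have hpinj : Function.Injective fun i => (p i : ι) := Subtype.val_injective.comp p.injective
  have hqinj : Function.Injective fun i => (q i : ι) := Subtype.val_injective.comp q.injective
  -- Otherwise a threshold just above the i-th positive ratio has at least i + 1 positive indices
  -- below it and at most i others, against `hlow`.
  have h1 : ∀ i, t (q (Fin.castAdd g i)) < t (p i) := by
    intro i
    by_contra hcon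
    have hcon := lt_of_le_of_ne (not_lt.mp hcon) (hpq _ _)
    obtain ⟨τ, hτp, hτ⟩ := exists_gt_forall_lt t (t (p i))
    have h2 := hlow τ fun j hj => by
      rcases lt_or_ge (t (p i)) (t j) with h | h
      · exact (hτ j h).ne' hj
      · linarith
    have h3 : (i : ℕ) + 1 ≤ (Finset.univ.filter fun i => 0 < h i ∧ t i < τ).card := by
      have : ((Finset.Iic i).image fun i => (p i : ι)) ⊆
          Finset.univ.filter fun i => 0 < h i ∧ t i < τ := by
        intro x hx
        obtain ⟨j, hj, rfl⟩ := Finset.mem_image.mp hx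
        have : t (p j) ≤ t (p i) := hp.monotone (Finset.mem_Iic.mp hj)
        simp only [Finset.mem_filter, Finset.mem_univ, true_and]
        exact ⟨(p j).2, by linarith⟩
      have := Finset.card_le_card this
      rwa [Finset.card_image_of_injective _ hpinj, Fin.card_Iic] at this
    have h4 : (Finset.univ.filter fun i => ¬ 0 < h i ∧ t i < τ).card ≤ i := by
      have : (Finset.univ.filter fun i => ¬ 0 < h i ∧ t i < τ) ⊆
          ((Finset.Iio (Fin.castAdd g i)).image fun i => (q i : ι)) := by
        intro x hx
        simp only [Finset.mem_filter, Finset.mem_univ, true_and] at hx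
        refine Finset.mem_image.mpr ⟨q.symm ⟨x, hx.1⟩, ?_, by simp⟩
        rw [Finset.mem_Iio, ← hq.lt_iff_lt]
        simp only [Function.comp_apply, Equiv.apply_symm_apply]
        exact hx.2.trans (hτ _ hcon)
      have := Finset.card_le_card this
      rwa [Finset.card_image_of_injective _ hqinj, Fin.card_Iio, Fin.val_castAdd] at this
    omega
  have h2 : ∀ i, t (p i) < t (q (Fin.addNat i g)) := by
    intro i
    by_contra hcon
    have hcon := lt_of_le_of_ne (not_lt.mp hcon) (hpq _ _).symm
    obtain ⟨τ, hτp, hτ⟩ := exists_lt_forall_lt t (t (p i))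
    have h2 := hhigh τ fun j hj => by
      rcases lt_or_ge (t j) (t (p i)) with h | h
      · exact (hτ j h).ne hj
      · linarith
    have h3 : a - (i : ℕ) ≤ (Finset.univ.filter fun i => 0 < h i ∧ τ < t i).card := by
      have : ((Finset.Ici i).image fun i => (p i : ι)) ⊆
          Finset.univ.filter fun i => 0 < h i ∧ τ < t i := by
        intro x hx
        obtain ⟨j, hj, rfl⟩ := Finset.mem_image.mp hx
        have : t (p i) ≤ t (p j) := hp.monotone (Finset.mem_Ici.mp hj)
        simp only [Finset.mem_filter, Finset.mem_univ, true_and]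
        exact ⟨(p j).2, by linarith⟩
      have := Finset.card_le_card this
      rwa [Finset.card_image_of_injective _ hpinj, Fin.card_Ici] at this
    have h4 : (Finset.univ.filter fun i => ¬ 0 < h i ∧ τ < t i).card ≤ a - 1 - i := by
      have : (Finset.univ.filter fun i => ¬ 0 < h i ∧ τ < t i) ⊆
          ((Finset.Ioi (Fin.addNat i g)).image fun i => (q i : ι)) := by
        intro x hx
        simp only [Finset.mem_filter, Finset.mem_univ, true_and] at hx
        refine Finset.mem_image.mpr ⟨q.symm ⟨x, hx.1⟩, ?_, by simp⟩
        rw [Finset.mem_Ioi, ← hq.lt_iff_lt]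
        simp only [Function.comp_apply, Equiv.apply_symm_apply]
        exact (hτ _ hcon).trans hx.2
      have := Finset.card_le_card this
      rw [Finset.card_image_of_injective _ hqinj, Fin.card_Ioi, Fin.val_addNat] at this
      omega
    have := i.2
    omega
  obtain ⟨V, hV1, hV2⟩ := exists_isometry_of_interlacing hp g hq h1 h2
  have hV1' : ∀ l m, ∑ j, V j l * V j m = if l = m then 1 else 0 := fun l m => by
    have := congrFun (congrFun hV1 l) m
    simpa [mul_apply, one_apply] using this
  have hV2' : ∀ l m, ∑ j, t (q j) * (V j l * V j m) = if l = m then t (p l) else 0 := fun l m => by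
    have := congrFun (congrFun hV2 l) m
    rw [mul_apply, diagonal_apply] at this
    simp only [mul_diagonal, transpose_apply, Function.comp_apply] at this
    rw [← this]
    exact Finset.sum_congr rfl fun j _ => by ring
  -- The identity on the positive indices and V on the negative ones, scaled by 1/√|h|. The two
  -- forms restrict to 1 - VᵀV and diag(t ∘ p) - Vᵀ diag(t ∘ q) V, both zero.
  let X : Matrix ι (Fin a) ℝ := of fun i l =>
    if hi : 0 < h i then (if p.symm ⟨i, hi⟩ = l then 1 else 0) / √(h i)
    else V (q.symm ⟨i, hi⟩) l / √(-h i)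
  have hXp : ∀ j l, X (p j) l = (if j = l then 1 else 0) / √(h (p j)) := fun j l => by
    simp [X, (p j).2]
  have hXq : ∀ j l, X (q j) l = V j l / √(-h (q j)) := fun j l => by
    have h3 := (q j).2
    simp only [X, of_apply, dif_neg h3, Subtype.coe_eta, Equiv.symm_apply_apply]
  have hsplit : ∀ F : ι → ℝ, ∑ i, F i = ∑ j, F (p j) + ∑ j, F (q j) := fun F => by
    rw [← Fintype.sum_subtype_add_sum_subtype (fun i => 0 < h i) F, ← Equiv.sum_comp p,
      ← Equiv.sum_comp q]
  have hp2 : ∀ j l m, h (p j) * (X (p j) l * X (p j) m) =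
      if j = l then (if l = m then 1 else 0) else 0 := fun j l m => by
    have h3 := (p j).2
    have h4 := Real.sqrt_pos.mpr h3
    rw [hXp, hXp, div_mul_div_comm, Real.mul_self_sqrt h3.le, mul_div_cancel₀ _ h3.ne']
    by_cases hjl : j = l
    · subst hjl; simp
    · simp [hjl]
  have hq2 : ∀ j l m, h (q j) * (X (q j) l * X (q j) m) = - (V j l * V j m) := fun j l m => by
    have h3 : 0 < - h (q j) := neg_pos.mpr (lt_of_le_of_ne (not_lt.mp (q j).2) (hh _))
    rw [hXq, hXq, div_mul_div_comm, Real.mul_self_sqrt h3.le]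
    have := hh (q j)
    field_simp
  refine ⟨X, fun y hy => ?_, fun l m => ?_, fun l m => ?_⟩
  · ext l
    have h3 := hy (p l)
    have h4 := (Real.sqrt_pos.mpr (p l).2).ne'
    simp only [hXp] at h3
    rw [Finset.sum_eq_single l (fun m _ hm => by simp [hm.symm]) (by simp)] at h3
    simpa [h4] using h3
  · rw [hsplit]
    simp only [hp2, hq2, Finset.sum_neg_distrib, hV1']
    simp
  · rw [hsplit]
    simp only [mul_assoc, hp2, hq2, mul_neg, Finset.sum_neg_distrib, hV2']
    simp

/-- Two real diagonal forms whose pencil is simple and always has at least `a` positive entries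
have a common isotropic subspace of dimension at least `a`. -/
theorem exists_isotropic_diagonal {ι : Type*} [Fintype ι] (h k : ι → ℝ) (hh : ∀ i, h i ≠ 0)
    (hk : ∀ i j, i ≠ j → k i * h j ≠ k j * h i) (a : ℕ)
    (ha : ∀ α β : ℝ, (∀ i, α * h i + β * k i ≠ 0) →
      a ≤ (Finset.univ.filter fun i => 0 < α * h i + β * k i).card) :
    ∃ a', a ≤ a' ∧ ∃ X : Matrix ι (Fin a') ℝ,
      (∀ y : Fin a' → ℂ, (∀ i, ∑ l, (X i l : ℂ) * y l = 0) → y = 0) ∧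
      (∀ l m, ∑ i, h i * (X i l * X i m) = 0) ∧ (∀ l m, ∑ i, k i * (X i l * X i m) = 0) := by
  classical
  rcases isEmpty_or_nonempty ι with hι | hι
  · have := ha 1 0 (fun i => isEmptyElim i)
    refine ⟨a, le_rfl, 0, fun y _ => ?_, by simp, by simp⟩
    have ha0 : a = 0 := by simpa using this
    subst ha0
    exact Subsingleton.elim _ _
  let D : Set (ℝ × ℝ) := {d | ∀ i, d.1 * h i + d.2 * k i ≠ 0}
  let cnt : ℝ × ℝ → ℕ := fun d => (Finset.univ.filter fun i => 0 < d.1 * h i + d.2 * k i).card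
  have hD : D.Nonempty := ⟨(1, 0), fun i => by simpa using hh i⟩
  -- A nondegenerate combination with the fewest positive entries; rotating the pencil makes it the
  -- first form h'.
  obtain ⟨⟨α, β⟩, hd, hmin⟩ : ∃ d ∈ D, ∀ d' ∈ D, cnt d ≤ cnt d' :=
    ⟨Function.argminOn cnt D hD, Function.argminOn_mem _ _ _,
      fun d' hd' => Function.argminOn_le cnt D hd'⟩
  have hαβ : α ^ 2 + β ^ 2 ≠ 0 := fun h0 => by
    have hα : α = 0 := by nlinarith [sq_nonneg α, sq_nonneg β]
    have hβ : β = 0 := by nlinarith [sq_nonneg α, sq_nonneg β]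
    obtain ⟨i⟩ := hι
    exact hd i (by simp [hα, hβ])
  let h' : ι → ℝ := fun i => α * h i + β * k i
  let k' : ι → ℝ := fun i => α * k i - β * h i
  have hh' : ∀ i, h' i ≠ 0 := hd
  let t : ι → ℝ := fun i => k' i / h' i
  have hkt : ∀ i, k' i = t i * h' i := fun i => (div_mul_cancel₀ _ (hh' i)).symm
  have ht : Function.Injective t := by
    intro i j hij
    by_contra hne
    have h1 := (div_eq_div_iff (hh' i) (hh' j)).mp hij
    have h2 : (α ^ 2 + β ^ 2) * (k i * h j - k j * h i) = 0 := by
      simp only [h', k'] at h1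
      linear_combination h1
    exact hk i j hne (sub_eq_zero.mp ((mul_eq_zero.mp h2).resolve_left hαβ))
  -- Every threshold τ is itself a direction of the pencil. Passing to it keeps the positive entries
  -- above τ and replaces those below by the negative ones below, so minimality compares these two
  -- counts.
  have hcomb : ∀ τ i, (-β - τ * α) * h i + (α - τ * β) * k i = h' i * (t i - τ) := fun τ i => by
    rw [mul_sub, mul_comm (h' i) (t i), ← hkt]
    simp only [h', k']; ring
  have hpos : ∀ τ, (∀ i, t i ≠ τ) → (Finset.univ.filter fun i => 0 < h' i).card =
      (Finset.univ.filter fun i => 0 < h' i ∧ t i < τ).card +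
      (Finset.univ.filter fun i => 0 < h' i ∧ τ < t i).card := fun τ hτ => by
    rw [← Finset.card_union_of_disjoint, ← Finset.filter_or]
    · congr 1
      ext i
      simp only [Finset.mem_filter, Finset.mem_univ, true_and, ← and_or_left]
      exact ⟨fun h => ⟨h, (hτ i).lt_or_gt⟩, fun h => h.1⟩
    · refine Finset.disjoint_filter.mpr fun i _ h1 h2 => ?_
      exact lt_asymm h1.2 h2.2
  have hneg : ∀ i, ¬ 0 < h' i ↔ h' i < 0 := fun i =>
    ⟨fun h => lt_of_le_of_ne (not_lt.mp h) (hh' i), fun h => h.not_gt⟩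
  obtain ⟨X, hX0, hX1, hX2⟩ := exists_isotropic_of_minimal h' t hh' ht
    (fun τ hτ => by
      have h1 := hmin (-β - τ * α, α - τ * β) fun i => by
        simp only [hcomb]
        exact mul_ne_zero (hh' i) (sub_ne_zero.mpr (hτ i))
      have h2 : cnt (-β - τ * α, α - τ * β) ≤
          (Finset.univ.filter fun i => 0 < h' i ∧ τ < t i).card +
          (Finset.univ.filter fun i => ¬ 0 < h' i ∧ t i < τ).card := by
        refine le_trans (Finset.card_le_card fun i hi => ?_) (Finset.card_union_le _ _)
        simp only [Finset.mem_filter, Finset.mem_univ, true_and, hcomb] at hi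
        simp only [Finset.mem_union, Finset.mem_filter, Finset.mem_univ, true_and, hneg]
        rcases pos_and_pos_or_neg_and_neg_of_mul_pos hi with h | h
        · exact Or.inl ⟨h.1, sub_pos.mp h.2⟩
        · exact Or.inr ⟨h.1, sub_neg.mp h.2⟩
      have h3 := hpos τ hτ
      have h4 : cnt (α, β) = (Finset.univ.filter fun i => 0 < h' i).card := rfl
      omega)
    (fun τ hτ => by
      have hc : ∀ i, (β + τ * α) * h i + (τ * β - α) * k i = h' i * (τ - t i) := fun i => by
        linear_combination -hcomb τ i
      have h1 := hmin (β + τ * α, τ * β - α) fun i => by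
        simp only [hc]
        exact mul_ne_zero (hh' i) (sub_ne_zero.mpr (hτ i).symm)
      have h2 : cnt (β + τ * α, τ * β - α) ≤
          (Finset.univ.filter fun i => 0 < h' i ∧ t i < τ).card +
          (Finset.univ.filter fun i => ¬ 0 < h' i ∧ τ < t i).card := by
        refine le_trans (Finset.card_le_card fun i hi => ?_) (Finset.card_union_le _ _)
        simp only [Finset.mem_filter, Finset.mem_univ, true_and, hc] at hi
        simp only [Finset.mem_union, Finset.mem_filter, Finset.mem_univ, true_and, hneg]
        rcases pos_and_pos_or_neg_and_neg_of_mul_pos hi with h | h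
        · exact Or.inl ⟨h.1, sub_pos.mp h.2⟩
        · exact Or.inr ⟨h.1, sub_neg.mp h.2⟩
      have h3 := hpos τ hτ
      have h4 : cnt (α, β) = (Finset.univ.filter fun i => 0 < h' i).card := rfl
      omega)
  simp only [← hkt] at hX2
  refine ⟨_, ha α β hd, X, hX0, fun l m => ?_, fun l m => ?_⟩
  · have h1 : (α ^ 2 + β ^ 2) * ∑ i, h i * (X i l * X i m) =
        α * ∑ i, h' i * (X i l * X i m) - β * ∑ i, k' i * (X i l * X i m) := by
      simp only [Finset.mul_sum, ← Finset.sum_sub_distrib]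
      exact Finset.sum_congr rfl fun i _ => by simp only [h', k']; ring
    rw [hX1, hX2, mul_zero, mul_zero, sub_zero] at h1
    exact (mul_eq_zero.mp h1).resolve_left hαβ
  · have h1 : (α ^ 2 + β ^ 2) * ∑ i, k i * (X i l * X i m) =
        β * ∑ i, h' i * (X i l * X i m) + α * ∑ i, k' i * (X i l * X i m) := by
      simp only [Finset.mul_sum, ← Finset.sum_add_distrib]
      exact Finset.sum_congr rfl fun i _ => by simp only [h', k']; ring
    rw [hX1, hX2, mul_zero, mul_zero, add_zero] at h1
    exact (mul_eq_zero.mp h1).resolve_left hαβ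


/-! ### Hermitian pencils in eigenvector coordinates -/

section Pencil

variable {n : ℕ} {G : Matrix (Fin n) (Fin n) ℂ} {μ : Fin n → ℂ}

/-- Hermitian symmetry of both matrices gives G i j μ j = G i j star (μ i). -/
theorem eq_star_of_pencil_ne_zero (hG : G.IsHermitian) (hL : (G * diagonal μ).IsHermitian)
    {i j : Fin n} (h : G i j ≠ 0) : μ j = star (μ i) := by
  have h1 := hL.apply i j
  rw [mul_diagonal, mul_diagonal, star_mul', hG.apply i j] at h1
  exact (mul_left_cancel₀ h h1).symm

theorem exists_pencil_ne_zero (hdet : G.det ≠ 0) (i : Fin n) : ∃ j, G i j ≠ 0 := by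
  by_contra hcon
  push Not at hcon
  exact hdet (det_eq_zero_of_row_eq_zero i hcon)

theorem pencil_diag_ne_zero (hG : G.IsHermitian) (hL : (G * diagonal μ).IsHermitian)
    (hμ : Function.Injective μ) (hdet : G.det ≠ 0) {i : Fin n} (hi : (μ i).im = 0) :
    G i i ≠ 0 := by
  obtain ⟨j, hj⟩ := exists_pencil_ne_zero hdet i
  have h1 := eq_star_of_pencil_ne_zero hG hL hj
  have h2 : star (μ i) = μ i := Complex.conj_eq_iff_im.mpr hi
  rw [h2] at h1
  rwa [hμ h1] at hj

/-- Nonsingularity gives every row a nonzero entry, which pairs each μ i with its conjugate. -/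
theorem card_im_neg_le_card_im_pos (hG : G.IsHermitian) (hL : (G * diagonal μ).IsHermitian)
    (hμ : Function.Injective μ) (hdet : G.det ≠ 0) :
    (Finset.univ.filter fun i => (μ i).im < 0).card ≤
      (Finset.univ.filter fun i => 0 < (μ i).im).card := by
  choose f hf using exists_pencil_ne_zero (G := G) hdet
  have hf' : ∀ i, μ (f i) = star (μ i) := fun i => eq_star_of_pencil_ne_zero hG hL (hf i)
  refine Finset.card_le_card_of_injOn f (fun i hi => ?_) fun i _ j _ hij => ?_
  · simp only [Finset.coe_filter, Finset.mem_univ, true_and, Set.mem_ofPred_eq] at hi ⊢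
    rw [hf']
    simpa using hi
  · apply hμ
    have := congrArg μ hij
    rw [hf', hf'] at this
    exact star_injective this

/-- On vectors without components in the lower half plane both forms are diagonal. -/
theorem pencil_form_eq (hG : G.IsHermitian) (hL : (G * diagonal μ).IsHermitian)
    (hμ : Function.Injective μ) {y : Fin n → ℂ} (hy : ∀ i, (μ i).im < 0 → y i = 0) (α β : ℂ) :
    star y ⬝ᵥ ((α • G + β • (G * diagonal μ)) *ᵥ y) =
      ∑ i : {i // (μ i).im = 0}, ((α + β * (μ i).re) * (G i i).re) * (star (y i) * y i) := by
  have h1 : ∀ i, ∑ j, star (y i) * ((α • G + β • (G * diagonal μ)) i j * y j) =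
      if (μ i).im = 0 then ((α + β * (μ i).re) * (G i i).re) * (star (y i) * y i) else 0 := by
    intro i
    -- A nonzero off-diagonal entry couples conjugate nonreal eigenvalues, and one of the two
    -- coordinates belongs to the lower half plane.
    have hz : ∀ j, j ≠ i → star (y i) * ((α • G + β • (G * diagonal μ)) i j * y j) = 0 := by
      intro j hj
      by_cases hGij : G i j = 0
      · simp [hGij, mul_diagonal]
      have h2 := eq_star_of_pencil_ne_zero hG hL hGij
      have h3 : (μ j).im = -(μ i).im := by rw [h2]; rfl
      rcases lt_trichotomy (μ i).im 0 with h | h | h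
      · simp [hy i h]
      · refine absurd (hμ ?_) hj
        rw [h2]; exact Complex.conj_eq_iff_im.mpr h
      · simp [hy j (by linarith)]
    rw [Finset.sum_eq_single i (fun j _ hj => hz j hj) (by simp)]
    split_ifs with him
    · have h2 : ((μ i).re : ℂ) = μ i := Complex.ext rfl (by simp [him])
      have h3 : ((G i i).re : ℂ) = G i i := hG.coe_re_apply_self i
      rw [h2, h3]
      simp [mul_diagonal]
      ring
    · by_cases hGii : G i i = 0
      · simp [hGii, mul_diagonal]
      · have h2 := eq_star_of_pencil_ne_zero hG hL hGii
        exact absurd (Complex.conj_eq_iff_im.mp h2.symm) him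
  simp only [dotProduct, mulVec, Finset.mul_sum, Pi.star_apply]
  rw [Finset.sum_congr rfl fun i _ => h1 i, ← Finset.sum_filter]
  exact Finset.sum_subtype _ (by simp) _

/-- Common isotropic subspaces of a simple pencil of Hermitian forms in canonical coordinates. -/
theorem exists_isotropic_of_pencil (hG : G.IsHermitian) (hL : (G * diagonal μ).IsHermitian)
    (hμ : Function.Injective μ) (hdet : G.det ≠ 0) (k : ℕ)
    (hpos : ∀ α β : ℝ, (α ≠ 0 ∨ β ≠ 0) → ∃ W : Submodule ℂ (Fin n → ℂ),
      k ≤ Module.finrank ℂ W ∧ ∀ w ∈ W, w ≠ 0 →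
        0 < hform ((α : ℂ) • G + (β : ℂ) • (G * diagonal μ)) w) :
    ∃ W : Submodule ℂ (Fin n → ℂ), k ≤ Module.finrank ℂ W ∧
      ∀ w ∈ W, ∀ α β : ℂ, star w ⬝ᵥ ((α • G + β • (G * diagonal μ)) *ᵥ w) = 0 := by
  classical
  let h : {i // (μ i).im = 0} → ℝ := fun i => (G i i).re
  let r : {i // (μ i).im = 0} → ℝ := fun i => (μ i).re * (G i i).re
  have hh : ∀ i, h i ≠ 0 := fun i h0 => by
    refine pencil_diag_ne_zero hG hL hμ hdet i.2 ?_
    have h1 : ((G i i).re : ℂ) = G i i := hG.coe_re_apply_self i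
    rw [← h1]
    exact_mod_cast h0
  have hr : ∀ i j, i ≠ j → r i * h j ≠ r j * h i := fun i j hij heq => by
    have h1 : ((μ i).re - (μ j).re) * (h i * h j) = 0 := by
      simp only [r, h] at heq ⊢
      linear_combination heq
    have h2 := (mul_eq_zero.mp h1).resolve_right (mul_ne_zero (hh i) (hh j))
    exact hij (Subtype.ext (hμ (Complex.ext (sub_eq_zero.mp h2) (i.2.trans j.2.symm))))
  -- the part of the positive subspace seen by the lower half plane and the positive real part
  have hcount : ∀ α β : ℝ, (α ≠ 0 ∨ β ≠ 0) →
      k ≤ (Finset.univ.filter fun i => (μ i).im < 0).card +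
        (Finset.univ.filter fun i => 0 < α * h i + β * r i).card := by
    intro α β hαβ
    obtain ⟨W, hWk, hW⟩ := hpos α β hαβ
    -- A vector of W killed by f has no lower half-plane part and only nonpositive diagonal terms,
    -- against positivity on W.
    let f : W →ₗ[ℂ] ({i // (μ i).im < 0} → ℂ) × ({i // 0 < α * h i + β * r i} → ℂ) :=
      ((LinearMap.pi fun i : {i // (μ i).im < 0} => LinearMap.proj (i : Fin n)).prod
        (LinearMap.pi fun i : {i // 0 < α * h i + β * r i} =>
          LinearMap.proj ((i : {i // (μ i).im = 0}) : Fin n))).comp W.subtype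
    have hf : Function.Injective f := by
      rw [injective_iff_map_eq_zero]
      intro w hw
      by_contra hw0
      have h1 := hW w w.2 (by simpa using hw0)
      have hz1 : ∀ i, (μ i).im < 0 → (w : Fin n → ℂ) i = 0 := fun i hi =>
        congrFun (congrArg Prod.fst hw) ⟨i, hi⟩
      have hz2 : ∀ i, 0 < α * h i + β * r i → (w : Fin n → ℂ) i = 0 := fun i hi =>
        congrFun (congrArg Prod.snd hw) ⟨i, hi⟩
      rw [hform, pencil_form_eq hG hL hμ hz1, Complex.re_sum] at h1
      refine absurd h1 (not_lt.mpr (Finset.sum_nonpos fun i _ => ?_))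
      have e : ((α : ℂ) + β * (μ i).re) * (G i i).re * (star ((w : Fin n → ℂ) i) *
          (w : Fin n → ℂ) i) = ((α * h i + β * r i) * ‖(w : Fin n → ℂ) i‖ ^ 2 : ℝ) := by
        have : star ((w : Fin n → ℂ) i) * (w : Fin n → ℂ) i =
          (‖(w : Fin n → ℂ) i‖ : ℂ) ^ 2 := Complex.conj_mul' _
        rw [this]
        simp only [h, r]
        push_cast
        ring
      rw [e, Complex.ofReal_re]
      rcases lt_or_ge 0 (α * h i + β * r i) with hp | hp
      · simp [hz2 i hp]
      · exact mul_nonpos_of_nonpos_of_nonneg hp (by positivity)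
    have h2 := LinearMap.finrank_le_finrank_of_injective hf
    rw [Module.finrank_prod, Module.finrank_fintype_fun_eq_card,
      Module.finrank_fintype_fun_eq_card, Fintype.card_subtype, Fintype.card_subtype] at h2
    exact hWk.trans h2
  -- The remaining dimension is supplied by the real eigenvalues; the subtraction is truncated. The
  -- case α = β = 0 arises only when no μ i is real.
  obtain ⟨a, ha, X, hX0, hX1, hX2⟩ := exists_isotropic_diagonal h r hh hr
    (k - (Finset.univ.filter fun i => (μ i).im < 0).card) fun α β hne => by
      by_cases h0 : α ≠ 0 ∨ β ≠ 0
      · have := hcount α β h0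
        omega
      · push Not at h0
        have he : IsEmpty {i // (μ i).im = 0} := ⟨fun i => hne i (by simp [h0])⟩
        have := hcount 1 0 (Or.inl one_ne_zero)
        simp only [Finset.univ_eq_empty, Finset.filter_empty, Finset.card_empty] at this ⊢
        omega
  -- Free upper half-plane coordinates, real ones through X, lower ones zero.
  let f : ({i // 0 < (μ i).im} → ℂ) × (Fin a → ℂ) →ₗ[ℂ] (Fin n → ℂ) :=
    { toFun := fun p i => if hi : 0 < (μ i).im then p.1 ⟨i, hi⟩ else
        if hi : (μ i).im = 0 then ∑ l, (X ⟨i, hi⟩ l : ℂ) * p.2 l else 0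
      map_add' := fun p q => by
        ext i
        simp only [Prod.fst_add, Prod.snd_add, Pi.add_apply, mul_add, Finset.sum_add_distrib]
        split_ifs <;> simp
      map_smul' := fun c p => by
        ext i
        simp only [Prod.smul_fst, Prod.smul_snd, Pi.smul_apply, smul_eq_mul, RingHom.id_apply,
          mul_left_comm _ c, ← Finset.mul_sum]
        split_ifs <;> simp }
  have hf1 : ∀ p i (hi : 0 < (μ i).im), f p i = p.1 ⟨i, hi⟩ := fun p i hi => by
    simp [f, hi]
  have hf2 : ∀ p (i : {i // (μ i).im = 0}), f p i = ∑ l, (X i l : ℂ) * p.2 l := fun p i => by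
    simp [f, i.2]
  have hf3 : ∀ p i, (μ i).im < 0 → f p i = 0 := fun p i hi => by
    simp [f, hi.not_gt, hi.ne]
  have hf : Function.Injective f := by
    rw [injective_iff_map_eq_zero]
    intro p hp
    refine Prod.ext (funext fun i => ?_) (hX0 _ fun i => ?_)
    · rw [← hf1 p i i.2, hp]; rfl
    · rw [← hf2, hp]; rfl
  refine ⟨LinearMap.range f, ?_, ?_⟩
  · rw [LinearMap.finrank_range_of_inj hf, Module.finrank_prod,
      Module.finrank_fintype_fun_eq_card, Module.finrank_fintype_fun_eq_card,
      Fintype.card_subtype, Fintype.card_fin]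
    have := card_im_neg_le_card_im_pos hG hL hμ hdet
    omega
  · rintro _ ⟨p, rfl⟩ α β
    rw [pencil_form_eq hG hL hμ (hf3 p)]
    have e : ∀ d : {i // (μ i).im = 0} → ℝ, (∀ l m, ∑ i, d i * (X i l * X i m) = 0) →
        ∑ i, (d i : ℂ) * (star (f p i) * f p i) = 0 := by
      intro d hd
      have h1 : ∀ i : {i // (μ i).im = 0}, (d i : ℂ) * (star (f p i) * f p i) =
          ∑ l, ∑ m, (star (p.2 l) * p.2 m) * ((d i * (X i l * X i m) : ℝ) : ℂ) := by
        intro i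
        rw [hf2, star_sum, Finset.sum_mul_sum, Finset.mul_sum]
        refine Finset.sum_congr rfl fun l _ => ?_
        rw [Finset.mul_sum]
        refine Finset.sum_congr rfl fun m _ => ?_
        have : star ((X i l : ℂ) * p.2 l) = X i l * star (p.2 l) := by simp
        rw [this]
        push_cast
        ring
      rw [Finset.sum_congr rfl fun i _ => h1 i, Finset.sum_comm]
      refine Finset.sum_eq_zero fun l _ => ?_
      rw [Finset.sum_comm]
      refine Finset.sum_eq_zero fun m _ => ?_
      rw [← Finset.mul_sum, ← Complex.ofReal_sum, hd, Complex.ofReal_zero, mul_zero]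
    have h1 := e h hX1
    have h2 := e r hX2
    have h3 : ∑ i : {i // (μ i).im = 0}, ((α + β * (μ i).re) * (G i i).re) *
        (star (f p i) * f p i) = α * ∑ i, (h i : ℂ) * (star (f p i) * f p i) +
          β * ∑ i, (r i : ℂ) * (star (f p i) * f p i) := by
      rw [Finset.mul_sum, Finset.mul_sum, ← Finset.sum_add_distrib]
      refine Finset.sum_congr rfl fun i _ => ?_
      simp only [h, r]
      push_cast
      ring
    rw [h3, h1, h2, mul_zero, mul_zero, add_zero]

end Pencil


/-! ### Simple pencils and their density -/

/-- The resultant is taken with fixed formal degrees, so that it commutes with evaluation in a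
family of matrices. -/
theorem charpoly_separable_iff {n : ℕ} (M : Matrix (Fin n) (Fin n) ℂ) :
    M.charpoly.Separable ↔ M.charpoly.resultant M.charpoly.derivative n (n - 1) ≠ 0 := by
  have h1 : M.charpoly.natDegree = n := by
    rw [Matrix.charpoly_natDegree_eq_dim, Fintype.card_fin]
  have h2 : M.charpoly.derivative.natDegree = n - 1 := by rw [natDegree_derivative, h1]
  have h3 := isUnit_resultant_iff_isCoprime (g := M.charpoly.derivative) M.charpoly_monic
  rw [h1, h2, isUnit_iff_ne_zero] at h3
  exact h3.symm

/-- In a polynomial family of matrices, separability of the characteristic polynomial at one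
parameter implies it at all but finitely many parameters. -/
theorem finite_not_separable_charpoly {n : ℕ} (M : Matrix (Fin n) (Fin n) ℂ[X]) {t₀ : ℂ}
    (h0 : (M.map (eval t₀)).charpoly.Separable) :
    {t : ℂ | ¬ (M.map (eval t)).charpoly.Separable}.Finite := by
  set R := M.charpoly.resultant M.charpoly.derivative n (n - 1)
  have hR : ∀ t : ℂ, (M.map (eval t)).charpoly.Separable ↔ R.eval t ≠ 0 := fun t => by
    rw [charpoly_separable_iff, ← coe_evalRingHom, Matrix.charpoly_map, derivative_map,
      resultant_map_map]
  have hR0 : R ≠ 0 := fun h => by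
    rw [hR, h, eval_zero] at h0
    exact h0 rfl
  refine (finite_setOfPred_isRoot hR0).subset fun t ht => ?_
  rw [Set.mem_ofPred_eq, hR, not_not] at ht
  exact ht

/-- A matrix with simple spectrum is diagonalizable. -/
theorem exists_eigenbasis_of_separable {n : ℕ} {T : Matrix (Fin n) (Fin n) ℂ}
    (h : T.charpoly.Separable) : ∃ (S : Matrix (Fin n) (Fin n) ℂ) (μ : Fin n → ℂ),
      IsUnit S ∧ Function.Injective μ ∧ T * S = S * diagonal μ := by
  have hμ : Function.Injective (eig T) := by
    have h1 := nodup_roots h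
    rw [← map_eig] at h1
    intro i j hij
    exact Multiset.inj_on_of_nodup_map h1 i (Finset.mem_univ i) j (Finset.mem_univ j) hij
  have hev : ∀ j, Module.End.HasEigenvalue (Matrix.toLin' T) (eig T j) := fun j => by
    rw [Module.End.hasEigenvalue_iff_isRoot_charpoly, Matrix.charpoly_toLin']
    refine Polynomial.isRoot_of_mem_roots ?_
    rw [← map_eig]
    exact Multiset.mem_map_of_mem _ (Finset.mem_univ j)
  choose v hv using fun j => (hev j).exists_hasEigenvector
  have hli := Module.End.eigenvectors_linearIndependent' _ (eig T) hμ v hv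
  refine ⟨(of v)ᵀ, eig T, ?_, hμ, ?_⟩
  · rw [← linearIndependent_cols_iff_isUnit]
    exact hli
  · ext i j
    have h1 := congrFun (hv j).apply_eq_smul i
    rw [mul_diagonal]
    simpa [mul_apply, mulVec, dotProduct, mul_comm] using h1

/-- Pencils of Hermitian matrices with nonsingular first member and simple spectrum. -/
def IsSimplePencil {n : ℕ} (H K : Matrix (Fin n) (Fin n) ℂ) : Prop :=
  H.det ≠ 0 ∧ ∃ (S : Matrix (Fin n) (Fin n) ℂ) (μ : Fin n → ℂ),
    IsUnit S ∧ Function.Injective μ ∧ K * S = H * S * diagonal μ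

/-- Congruence by S preserves Hermitian forms and turns the pencil into G and G diag(μ). -/
theorem exists_isotropic_of_isSimplePencil {n : ℕ} {H K : Matrix (Fin n) (Fin n) ℂ}
    (hH : H.IsHermitian) (hK : K.IsHermitian) (hHK : IsSimplePencil H K) (k : ℕ)
    (hpos : ∀ α β : ℝ, (α ≠ 0 ∨ β ≠ 0) → ∃ W : Submodule ℂ (Fin n → ℂ),
      k ≤ Module.finrank ℂ W ∧ ∀ w ∈ W, w ≠ 0 →
        0 < hform ((α : ℂ) • H + (β : ℂ) • K) w) :
    ∃ W : Submodule ℂ (Fin n → ℂ), k ≤ Module.finrank ℂ W ∧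
      ∀ w ∈ W, ∀ α β : ℂ, star w ⬝ᵥ ((α • H + β • K) *ᵥ w) = 0 := by
  obtain ⟨hdet, S, μ, hS, hμ, hKS⟩ := hHK
  have hSdet : IsUnit S.det := (isUnit_iff_isUnit_det S).mp hS
  have hSS : S * S⁻¹ = 1 := mul_nonsing_inv S hSdet
  have hSS' : S⁻¹ * S = 1 := nonsing_inv_mul S hSdet
  let e : (Fin n → ℂ) ≃ₗ[ℂ] (Fin n → ℂ) := Matrix.toLin'OfInv hSS' hSS
  have he : ∀ w, e w = S *ᵥ w := fun w => rfl
  set G := Sᴴ * H * S with hGdef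
  have hGμ : G * diagonal μ = Sᴴ * K * S := by
    rw [hGdef, Matrix.mul_assoc Sᴴ, Matrix.mul_assoc, Matrix.mul_assoc Sᴴ K, hKS]
  have hform_eq : ∀ (α β : ℂ) w, star w ⬝ᵥ ((α • G + β • (G * diagonal μ)) *ᵥ w) =
      star (S *ᵥ w) ⬝ᵥ ((α • H + β • K) *ᵥ (S *ᵥ w)) := fun α β w => by
    have h1 : α • G + β • (G * diagonal μ) = Sᴴ * (α • H + β • K) * S := by
      rw [hGμ, hGdef]
      simp [Matrix.mul_add, Matrix.add_mul]
    rw [h1, star_mulVec, ← dotProduct_mulVec, mulVec_mulVec, mulVec_mulVec, Matrix.mul_assoc]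
  have hG : G.IsHermitian := isHermitian_conjTranspose_mul_mul S hH
  have hL : (G * diagonal μ).IsHermitian := by
    rw [hGμ]; exact isHermitian_conjTranspose_mul_mul S hK
  have hGdet : G.det ≠ 0 := by
    rw [hGdef, det_mul, det_mul, det_conjTranspose]
    exact mul_ne_zero (mul_ne_zero (star_ne_zero.mpr hSdet.ne_zero) hdet) hSdet.ne_zero
  obtain ⟨W, hW, hiso⟩ := exists_isotropic_of_pencil hG hL hμ hGdet k fun α β hαβ => by
    obtain ⟨W, hW, hWpos⟩ := hpos α β hαβ
    refine ⟨W.map (e.symm : (Fin n → ℂ) →ₗ[ℂ] (Fin n → ℂ)), ?_, ?_⟩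
    · exact hW.trans_eq (LinearEquiv.finrank_map_eq e.symm W).symm
    · rintro _ ⟨w, hw, rfl⟩ hw0
      have h1 : S *ᵥ (e.symm w) = w := e.apply_symm_apply w
      rw [hform, LinearEquiv.coe_coe, hform_eq, h1]
      exact hWpos w hw fun h => hw0 (by rw [h, map_zero])
  refine ⟨W.map (e : (Fin n → ℂ) →ₗ[ℂ] (Fin n → ℂ)), ?_, ?_⟩
  · exact hW.trans_eq (LinearEquiv.finrank_map_eq e W).symm
  · rintro _ ⟨w, hw, rfl⟩ α β
    rw [LinearEquiv.coe_coe, he, ← hform_eq]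
    exact hiso w hw α β

theorem mem_closure_of_finite_compl {X : Type*} [TopologicalSpace X] {T : Set X} {γ : ℝ → X}
    (hγ : Continuous γ) (h : {t | γ t ∉ T}.Finite) : γ 0 ∈ closure T := by
  have h1 : Dense {t | γ t ∈ T} := by
    have h2 : {t | γ t ∈ T} = {t | γ t ∉ T}ᶜ := by ext t; simp
    rw [h2]
    exact h.countable.dense_compl ℝ
  exact closure_mono (Set.image_subset_iff.mpr fun t ht => ht)
    (image_closure_subset_closure_image hγ ⟨0, h1 0, rfl⟩)

theorem herm_add {n : ℕ} (x : ℂ) (B C : Matrix (Fin n) (Fin n) ℂ) :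
    herm x (B + C) = herm x B + herm x C := by
  simp only [herm, conjTranspose_add, smul_add]
  abel

theorem herm_add_left {n : ℕ} (x y : ℂ) (B : Matrix (Fin n) (Fin n) ℂ) :
    herm (x + y) B = herm x B + herm y B := by
  simp only [herm, star_add, add_smul, smul_add]
  abel

/-- In an eigenbasis of H take D with eigenvalues 0, …, n - 1; it commutes with H. -/
theorem exists_simple_multiplier {n : ℕ} {H : Matrix (Fin n) (Fin n) ℂ} (hH : H.IsHermitian) :
    ∃ D : Matrix (Fin n) (Fin n) ℂ, D.charpoly.Separable ∧ (H * D).IsHermitian := by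
  obtain ⟨U, hU, hHU⟩ := exists_unitary_hermEig hH
  refine ⟨U * diagonal (fun j : Fin n => ((j : ℕ) : ℂ)) * Uᴴ, ?_, ?_⟩
  · rw [charpoly_mul_comm, ← Matrix.mul_assoc, hU, Matrix.one_mul, charpoly_diagonal,
      separable_prod_X_sub_C_iff]
    intro i j hij
    exact Fin.ext (Nat.cast_injective hij)
  · have h1 : H * (U * diagonal (fun j : Fin n => ((j : ℕ) : ℂ)) * Uᴴ) =
        U * diagonal (fun j : Fin n => (hermEig hH j : ℂ) * ((j : ℕ) : ℂ)) * Uᴴ := by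
      conv_lhs => rw [hHU]
      rw [← diagonal_mul_diagonal]
      simp only [Matrix.mul_assoc]
      rw [← Matrix.mul_assoc Uᴴ U, hU, Matrix.one_mul]
    rw [h1, ← conjTranspose_conjTranspose U, conjTranspose_conjTranspose Uᴴ]
    refine isHermitian_conjTranspose_mul_mul Uᴴ (isHermitian_diagonal_of_self_adjoint _ ?_)
    ext j
    simp

/-- A real scalar shift makes Re B nonsingular. Adding iεHD then leaves H = Re B alone and moves Im
B by εHD. -/
theorem dense_isSimplePencil {n : ℕ} :
    Dense {B : Matrix (Fin n) (Fin n) ℂ | IsSimplePencil (herm 1 B) (herm (-Complex.I) B)} := by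
  set T := {B : Matrix (Fin n) (Fin n) ℂ | IsSimplePencil (herm 1 B) (herm (-Complex.I) B)}
  have h1 : {B : Matrix (Fin n) (Fin n) ℂ | (herm 1 B).det ≠ 0} ⊆ closure T := by
    intro B hB
    set H := herm 1 B with hHdef
    have hHu : IsUnit H.det := isUnit_iff_ne_zero.mpr hB
    obtain ⟨D, hD, hHD⟩ := exists_simple_multiplier (H := H) (herm_isHermitian 1 B)
    let γ : ℝ → Matrix (Fin n) (Fin n) ℂ := fun ε => B + (Complex.I * ε) • (H * D)
    have hγ : Continuous γ := by fun_prop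
    have hγ0 : γ 0 = B := by simp [γ]
    rw [← hγ0]
    refine mem_closure_of_finite_compl hγ ?_
    have hHγ : ∀ ε, herm 1 (γ ε) = H := fun ε => by
      rw [herm_add]
      have : herm 1 ((Complex.I * ε) • (H * D)) = 0 := by
        rw [herm, conjTranspose_smul, hHD.eq]
        simp
      rw [this, add_zero]
    have hKγ : ∀ ε : ℝ, herm (-Complex.I) (γ ε) = herm (-Complex.I) B + (ε : ℂ) • (H * D) :=
        fun ε => by
      rw [herm_add]
      congr 1
      rw [herm, conjTranspose_smul, hHD.eq, smul_smul, smul_smul, ← add_smul, smul_smul]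
      congr 1
      simp only [star_neg, star_mul', Complex.star_def, Complex.conj_I, Complex.conj_ofReal]
      linear_combination (-(ε : ℂ)) * Complex.I_mul_I
    -- H⁻¹(Im B + εHD) is ε times the value of this family at 1/ε. At parameter 0 the family is D,
    -- which has simple spectrum, so only finitely many ε are bad.
    let M : Matrix (Fin n) (Fin n) ℂ[X] := D.map (C : ℂ →+* ℂ[X]) +
      (X : ℂ[X]) • (H⁻¹ * herm (-Complex.I) B).map (C : ℂ →+* ℂ[X])
    have hM : ∀ t : ℂ, M.map (eval t) = D + t • (H⁻¹ * herm (-Complex.I) B) := fun t => by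
      ext i j
      simp only [M, map_apply, Matrix.add_apply, Matrix.smul_apply, smul_eq_mul, eval_add, eval_mul, eval_X,
        eval_C]
    have hfin := finite_not_separable_charpoly M (t₀ := 0) (by rw [hM]; simpa using hD)
    have hinj : Function.Injective fun ε : ℝ => ((ε⁻¹ : ℝ) : ℂ) :=
      Complex.ofReal_injective.comp inv_injective
    refine ((hfin.preimage hinj.injOn).union (Set.finite_singleton 0)).subset fun ε hε => ?_
    by_contra hcon
    simp only [Set.mem_union, Set.mem_preimage, Set.mem_ofPred_eq, Set.mem_singleton_iff, not_or,
      not_not] at hcon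
    obtain ⟨hsep, hε0⟩ := hcon
    refine hε ?_
    obtain ⟨S, μ, hS, hμ, hTS⟩ := exists_eigenbasis_of_separable hsep
    rw [hM] at hTS
    have hεc : (ε : ℂ) ≠ 0 := by exact_mod_cast hε0
    refine ⟨by rw [hHγ]; exact hB, S, fun j => ε * μ j, hS,
      fun i j hij => hμ (mul_left_cancel₀ hεc hij), ?_⟩
    rw [hHγ, hKγ]
    have h2 : herm (-Complex.I) B + (ε : ℂ) • (H * D) =
        (ε : ℂ) • (H * (D + ((ε⁻¹ : ℝ) : ℂ) • (H⁻¹ * herm (-Complex.I) B))) := by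
      rw [Matrix.mul_add, Matrix.mul_smul, ← Matrix.mul_assoc, mul_nonsing_inv H hHu,
        Matrix.one_mul, smul_add, smul_smul, Complex.ofReal_inv, mul_inv_cancel₀ hεc, one_smul,
        add_comm]
    have h3 : diagonal (fun j => (ε : ℂ) * μ j) = (ε : ℂ) • diagonal μ := by
      rw [← diagonal_smul]; rfl
    rw [h2, h3, Matrix.smul_mul, Matrix.mul_assoc, hTS, Matrix.mul_smul, Matrix.mul_assoc]
  have h2 : ∀ B : Matrix (Fin n) (Fin n) ℂ,
      B ∈ closure {B : Matrix (Fin n) (Fin n) ℂ | (herm 1 B).det ≠ 0} := by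
    intro B
    let γ : ℝ → Matrix (Fin n) (Fin n) ℂ := fun ε => B - (ε : ℂ) • 1
    have hγ : Continuous γ := by fun_prop
    have hγ0 : γ 0 = B := by simp [γ]
    rw [← hγ0]
    refine mem_closure_of_finite_compl hγ ?_
    have hfin := finite_setOfPred_isRoot (herm 1 B).charpoly_monic.ne_zero
    refine (hfin.preimage Complex.ofReal_injective.injOn).subset fun ε hε => ?_
    simp only [Set.mem_ofPred_eq, not_not] at hε
    rw [Set.mem_preimage, Set.mem_ofPred_eq, IsRoot.def, eval_charpoly]
    have h3 : scalar (Fin n) (ε : ℂ) - herm 1 B = -herm 1 (γ ε) := by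
      simp only [γ, herm, star_one, one_smul, conjTranspose_sub, conjTranspose_smul,
        conjTranspose_one, scalar_apply, Complex.star_def, Complex.conj_ofReal,
        ← smul_one_eq_diagonal]
      module
    rw [h3, det_neg, hε, mul_zero]
  intro B
  exact closure_minimal h1 isClosed_closure (h2 B)


/-! ### The rank-k range between the open and the closed half-plane intersections -/

theorem hform_herm {n : ℕ} (x : ℂ) (A : Matrix (Fin n) (Fin n) ℂ) (v : Fin n → ℂ) :
    hform (herm x A) v = (x * (star v ⬝ᵥ (A *ᵥ v))).re := by
  have h1 : star v ⬝ᵥ (Aᴴ *ᵥ v) = star (star v ⬝ᵥ (A *ᵥ v)) := by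
    rw [star_dotProduct, star_mulVec, conjTranspose_conjTranspose, ← dotProduct_mulVec]
  rw [hform, herm, smul_mulVec, add_mulVec, smul_mulVec, smul_mulVec, dotProduct_smul,
    dotProduct_add, dotProduct_smul, dotProduct_smul, h1]
  simp only [smul_eq_mul, Complex.star_def, ← map_mul]
  rw [Complex.add_conj]
  simp

/-- Orthogonal projections of rank `k`, described by closed conditions. -/
def projections (n k : ℕ) : Set (Matrix (Fin n) (Fin n) ℂ) :=
  {P | Pᴴ = P ∧ P * P = P ∧ P.trace = k}

theorem trace_eq_rank_of_idempotent {n : ℕ} {P : Matrix (Fin n) (Fin n) ℂ} (h : P * P = P) :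
    P.trace = P.rank := by
  have h1 : IsIdempotentElem (Matrix.toLin' P) := by
    rw [IsIdempotentElem, Module.End.mul_eq_comp, ← Matrix.toLin'_mul, h]
  have h2 := (LinearMap.IsIdempotentElem.isProj_range _ h1).trace
  rw [Matrix.trace_toLin'_eq] at h2
  rw [h2]; rfl

theorem mem_projections_iff {n k : ℕ} {P : Matrix (Fin n) (Fin n) ℂ} :
    P ∈ projections n k ↔ P.IsHermitian ∧ P * P = P ∧ P.rank = k := by
  refine and_congr_right fun _ => and_congr_right fun h => ?_
  rw [trace_eq_rank_of_idempotent h]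
  exact Nat.cast_inj

/-- Entries are bounded by 1 because P = PP* gives ∑_j |P i j|² = P i i. -/
theorem isCompact_projections (n k : ℕ) : IsCompact (projections n k) := by
  have hcl : IsClosed (projections n k) :=
    (isClosed_eq (by fun_prop) (by fun_prop)).inter
      ((isClosed_eq (by fun_prop) (by fun_prop)).inter
        (isClosed_eq (continuous_id.matrix_trace) continuous_const))
  have hK : IsCompact (Set.pi Set.univ fun _ : Fin n => Set.pi Set.univ fun _ : Fin n =>
      Metric.closedBall (0 : ℂ) 1) :=
    isCompact_univ_pi fun _ => isCompact_univ_pi fun _ => isCompact_closedBall 0 1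
  refine hK.of_isClosed_subset hcl fun (P : Matrix (Fin n) (Fin n) ℂ) hP i _ j _ => ?_
  obtain ⟨h1, h2, -⟩ := hP
  rw [mem_closedBall_zero_iff]
  have e1 : ∀ i j, ‖P i j‖ ^ 2 ≤ (P i i).re := fun i j => by
    have : P i i = ∑ j, ((‖P i j‖ ^ 2 : ℝ) : ℂ) := by
      conv_lhs => rw [← h2, mul_apply]
      refine Finset.sum_congr rfl fun l _ => ?_
      have h3 : P l i = star (P i l) := by
        conv_lhs => rw [← h1]
        rfl
      rw [h3]
      push_cast
      exact Complex.mul_conj' _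
    rw [this, ← Complex.ofReal_sum, Complex.ofReal_re]
    exact Finset.single_le_sum (f := fun j => ‖P i j‖ ^ 2) (fun _ _ => by positivity)
      (Finset.mem_univ j)
  have e2 : (P i i).re ≤ 1 := by
    have h3 := e1 i i
    have h4 := Complex.re_le_norm (P i i)
    nlinarith [norm_nonneg (P i i)]
  have h3 := e1 i j
  nlinarith [norm_nonneg (P i j)]

/-- Projecting a closed set along a compact factor gives a closed set. -/
theorem isClosed_exists_projection (n k : ℕ) :
    IsClosed {B : Matrix (Fin n) (Fin n) ℂ | ∃ P ∈ projections n k, P * B * P = 0} := by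
  have : CompactSpace (projections n k) := isCompact_iff_compactSpace.mp (isCompact_projections n k)
  have h1 : IsClosed {q : projections n k × Matrix (Fin n) (Fin n) ℂ |
      (q.1 : Matrix (Fin n) (Fin n) ℂ) * q.2 * q.1 = 0} :=
    isClosed_eq (by fun_prop) continuous_const
  have h2 := isClosedMap_snd_of_compactSpace _ h1
  convert h2 using 1
  ext B
  simp

/-- Collect k orthonormal vectors of W in X. The quadratic form of XᴴBX vanishes, so by complex
polarisation the matrix does, and P = XXᴴ. -/
theorem exists_projection_of_isotropic {n k : ℕ} {B : Matrix (Fin n) (Fin n) ℂ}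
    {W : Submodule ℂ (Fin n → ℂ)} (hW : k ≤ Module.finrank ℂ W)
    (hB : ∀ w ∈ W, star w ⬝ᵥ (B *ᵥ w) = 0) : ∃ P ∈ projections n k, P * B * P = 0 := by
  let e : (Fin n → ℂ) ≃ₗ[ℂ] EuclideanSpace ℂ (Fin n) := (WithLp.linearEquiv 2 ℂ (Fin n → ℂ)).symm
  let W' : Submodule ℂ (EuclideanSpace ℂ (Fin n)) :=
    W.map (e : (Fin n → ℂ) →ₗ[ℂ] EuclideanSpace ℂ (Fin n))
  have hW' : Module.finrank ℂ W' = Module.finrank ℂ W := LinearEquiv.finrank_map_eq e W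
  let b := stdOrthonormalBasis ℂ W'
  let X : Matrix (Fin n) (Fin k) ℂ :=
    of fun i l => (b (Fin.castLE (hW.trans_eq hW'.symm) l) : EuclideanSpace ℂ (Fin n)) i
  have hX : Xᴴ * X = 1 := by
    ext l m
    have h1 := orthonormal_iff_ite.mp b.orthonormal (Fin.castLE (hW.trans_eq hW'.symm) l)
      (Fin.castLE (hW.trans_eq hW'.symm) m)
    rw [Submodule.coe_inner, EuclideanSpace.inner_eq_star_dotProduct, dotProduct_comm] at h1
    rw [one_apply]
    simpa [mul_apply, X, dotProduct] using h1
  have hXW : ∀ z, X *ᵥ z ∈ W := fun z => by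
    have h1 : X *ᵥ z = ∑ l, z l • (e.symm (b (Fin.castLE (hW.trans_eq hW'.symm) l))) := by
      ext i
      simp [mulVec, dotProduct, X, e, mul_comm]
    rw [h1]
    refine W.sum_mem fun l _ => W.smul_mem _ ?_
    obtain ⟨w, hw, hwe⟩ := (b (Fin.castLE (hW.trans_eq hW'.symm) l)).2
    rw [← hwe]
    simpa using hw
  have hXBX : Xᴴ * B * X = 0 := by
    have h1 : Matrix.toEuclideanLin (Xᴴ * B * X) = 0 := by
      rw [← inner_map_self_eq_zero]
      intro z
      have h2 := hB _ (hXW z.ofLp)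
      rw [star_mulVec, ← dotProduct_mulVec, mulVec_mulVec, mulVec_mulVec] at h2
      rw [← inner_conj_symm, EuclideanSpace.inner_eq_star_dotProduct, map_eq_zero,
        dotProduct_comm]
      exact h2
    exact (LinearEquiv.map_eq_zero_iff _).mp h1
  refine ⟨X * Xᴴ, ⟨?_, ?_, ?_⟩, ?_⟩
  · rw [conjTranspose_mul, conjTranspose_conjTranspose]
  · rw [Matrix.mul_assoc, ← Matrix.mul_assoc Xᴴ, hX, Matrix.one_mul]
  · rw [trace_mul_comm, hX, trace_one, Fintype.card_fin]
  · have h1 : X * Xᴴ * B * (X * Xᴴ) = X * (Xᴴ * B * X) * Xᴴ := by simp only [Matrix.mul_assoc]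
    rw [h1, hXBX, Matrix.mul_zero, Matrix.zero_mul]

/-- If the eigenvalue with index `j` of `(x B + x̄ B*) / 2` is positive for all directions `x`, then
`B` is compressed to zero by a projection of rank `j + 1`. -/
theorem exists_projection_of_hermEig_pos {n : ℕ} (j : Fin n) {B : Matrix (Fin n) (Fin n) ℂ}
    (hB : ∀ x ∈ Metric.sphere (0 : ℂ) 1, 0 < hermEig (herm_isHermitian x B) j) :
    ∃ P ∈ projections n (j + 1), P * B * P = 0 := by
  let O : Set (Matrix (Fin n) (Fin n) ℂ) :=
    {B | ∀ x ∈ Metric.sphere (0 : ℂ) 1, 0 < hermEig (herm_isHermitian x B) j}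
  have hO : IsOpen O := by
    refine isOpen_forall_lt (isCompact_sphere 0 1)
      (f := fun _ : Matrix (Fin n) (Fin n) ℂ × ℂ => (0 : ℝ))
      (g := fun p => hermEig (herm_isHermitian p.2 p.1) j) continuous_const ?_
    refine continuous_hermEig (F := fun p : Matrix (Fin n) (Fin n) ℂ × ℂ => herm p.2 p.1) _ ?_ j
    unfold herm
    fun_prop
  -- The hypothesis is open and the conclusion closed in B, so a dense set of B suffices.
  refine closure_minimal ?_ (isClosed_exists_projection n (j + 1))
    (dense_isSimplePencil.open_subset_closure_inter hO hB)
  rintro B ⟨hBO, hBs⟩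
  have hcomb : ∀ α β : ℝ, (α : ℂ) • herm 1 B + (β : ℂ) • herm (-Complex.I) B =
      herm (α + β * -Complex.I) B := fun α β => by
    rw [herm_add_left, herm_real_mul, ← herm_real_mul B α 1, mul_one]
  obtain ⟨W, hW, hiso⟩ := exists_isotropic_of_isSimplePencil (herm_isHermitian 1 B)
    (herm_isHermitian (-Complex.I) B) hBs (j + 1) fun α β hαβ => by
      rw [hcomb]
      set x : ℂ := α + β * -Complex.I with hx
      have hx0 : x ≠ 0 := fun h => by
        have h1 := congrArg Complex.re h
        have h2 := congrArg Complex.im h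
        simp [hx] at h1 h2
        rcases hαβ with h | h
        · exact h h1
        · exact h h2
      have hn := norm_pos_iff.mpr hx0
      have h1 : 0 < hermEig (herm_isHermitian x B) j := by
        have e : x = (‖x‖ : ℝ) * (((‖x‖⁻¹ : ℝ) : ℂ) * x) := by
          rw [← mul_assoc, ← Complex.ofReal_mul, mul_inv_cancel₀ hn.ne', Complex.ofReal_one,
            one_mul]
        have h2 := hBO (((‖x‖⁻¹ : ℝ) : ℂ) * x) (by simp [hn.ne'])
        rw [hermEig_smul (herm_isHermitian _ B) (herm_isHermitian x B) hn
          (by rw [← herm_real_mul, ← e])]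
        exact mul_pos hn h2
      obtain ⟨W, hW, hWv⟩ := exists_submodule_hermEig (herm_isHermitian x B) j
      exact ⟨W, hW.ge, fun w hw hw0 =>
        (mul_pos h1 (hform_one_pos hw0)).trans_le (hWv w hw)⟩
  refine exists_projection_of_isotropic hW fun w hw => ?_
  -- B = Re B + i Im B.
  have h1 := hiso w hw 1 Complex.I
  have h2 : (1 : ℂ) • herm 1 B + Complex.I • herm (-Complex.I) B = B := by
    simp only [herm, star_one, one_smul, star_neg, Complex.star_def, Complex.conj_I, smul_add,
      smul_smul]
    have e1 : Complex.I * (1 / 2 * -Complex.I) = 1 / 2 := by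
      linear_combination (-1 / 2 : ℂ) * Complex.I_mul_I
    have e2 : Complex.I * (1 / 2 * - -Complex.I) = -(1 / 2) := by
      linear_combination (1 / 2 : ℂ) * Complex.I_mul_I
    rw [e1, e2]
    module
  rwa [h2] at h1

theorem weightedSupport_single {n : ℕ} (A : Matrix (Fin n) (Fin n) ℂ) (j : Fin n) (x : ℂ) :
    weightedSupport A (Pi.single j 1) x = hermEig (herm_isHermitian x A) j := by
  rw [weightedSupport, Finset.sum_eq_single j] <;> simp +contextual

theorem rankRange_subset {n : ℕ} (A : Matrix (Fin n) (Fin n) ℂ) (j : Fin n) :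
    rankRange (j + 1) A ⊆ weightedRange A (Pi.single j 1) := by
  rintro z ⟨P, hP, hPP, hrank, hPA⟩
  rw [mem_weightedRange_iff]
  intro x _
  rw [weightedSupport_single]
  refine le_hermEig _ j (LinearMap.range (Matrix.mulVecLin P)) ?_ _ ?_
  · have : Module.finrank ℂ (LinearMap.range (Matrix.mulVecLin P)) = j + 1 := hrank
    omega
  · rintro _ ⟨v, rfl⟩
    rw [mulVecLin_apply]
    set w := P *ᵥ v
    have hw : P *ᵥ w = w := by simp only [w, mulVec_mulVec, hPP]
    have h1 : star w ⬝ᵥ (A *ᵥ w) = z * (star w ⬝ᵥ w) := by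
      conv_lhs => rw [← hw]
      rw [star_mulVec, hP.eq, ← dotProduct_mulVec, mulVec_mulVec, mulVec_mulVec,
        hPA, smul_mulVec, dotProduct_smul, hw, smul_eq_mul]
    have h2 : star w ⬝ᵥ w = (hform 1 w : ℂ) := by
      rw [hform_one]
      push_cast
      exact Finset.sum_congr rfl fun i _ => Complex.conj_mul' _
    rw [hform_herm, h1, h2, ← mul_assoc, Complex.re_mul_ofReal]

/-- Translation by z reduces this to compressing A - z to zero: the shift lowers the eigenvalue by
Re(xz), and it stays positive. -/
theorem strict_subset_rankRange {n : ℕ} (A : Matrix (Fin n) (Fin n) ℂ) (j : Fin n) :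
    {v : ℂ | ∀ x ∈ Metric.sphere (0 : ℂ) 1, (x * v).re < weightedSupport A (Pi.single j 1) x} ⊆
      rankRange (j + 1) A := by
  intro z hz
  obtain ⟨P, hP, hPA⟩ := exists_projection_of_hermEig_pos j (B := A - z • 1) fun x hx => by
    have h1 := hz x hx
    rw [weightedSupport_single] at h1
    have h2 := hermEig_le_of_hform (herm_isHermitian x A) (herm_isHermitian x (A - z • 1))
      zero_le_one (ε := (x * z).re) (fun v => by
        have h2 : star v ⬝ᵥ v = (hform 1 v : ℂ) := by
          rw [hform_one]
          push_cast
          exact Finset.sum_congr rfl fun i _ => Complex.conj_mul' _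
        rw [hform_herm, hform_herm, sub_mulVec, dotProduct_sub,
          smul_mulVec, one_mulVec, dotProduct_smul, smul_eq_mul, h2, mul_sub, Complex.sub_re,
          ← mul_assoc, Complex.re_mul_ofReal, one_mul]) j
    linarith
  obtain ⟨h1, h2, h3⟩ := mem_projections_iff.mp hP
  refine ⟨P, h1, h2, h3, ?_⟩
  rw [Matrix.mul_sub, Matrix.sub_mul, Matrix.mul_smul, Matrix.mul_one, Matrix.smul_mul, h2,
    sub_eq_zero] at hPA
  exact hPA

theorem hasEigenvalue_of_isCValue_single {n : ℕ} {A : Matrix (Fin n) (Fin n) ℂ} {j : Fin n} {z : ℂ}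
    (h : IsCValue A (Pi.single j 1) z) : Module.End.HasEigenvalue (Matrix.toLin' A) z := by
  obtain ⟨σ, rfl⟩ := h
  have h1 : ∑ i, ((Pi.single j 1 : Fin n → ℝ) i : ℂ) * eig A (σ i) = eig A (σ j) := by
    rw [Finset.sum_eq_single j] <;> simp +contextual
  rw [h1, Module.End.hasEigenvalue_iff_isRoot_charpoly, Matrix.charpoly_toLin']
  refine Polynomial.isRoot_of_mem_roots ?_
  rw [← map_eig]
  exact Multiset.mem_map_of_mem _ (Finset.mem_univ_val _)

end WNR

/-! ### The two statements on ellipses -/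

theorem mainTheorem5 {n : ℕ} (A : Matrix (Fin n) (Fin n) ℂ) :
    (∀ (c : Fin n → ℝ) (f₁ f₂ : ℂ) (s : ℝ), dist f₁ f₂ < s →
      (∃ S : Finset ℂ, S.card = 2 * WNR.cDegree A c + 1 ∧
        (S : Set ℂ) ⊆ frontier (WNR.weightedRange A c) ∩ WNR.ellipse f₁ f₂ s) →
      WNR.IsCValue A c f₁ ∧ WNR.IsCValue A c f₂) ∧
    (∀ (k : ℕ), 1 ≤ k → k ≤ n → ∀ (f₁ f₂ : ℂ) (s : ℝ), dist f₁ f₂ < s →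
      (∃ S : Set ℂ, WNR.IsEllipticalArc f₁ f₂ s S ∧ S ⊆ frontier (WNR.rankRange k A)) →
      Module.End.HasEigenvalue (Matrix.toLin' A) f₁ ∧
        Module.End.HasEigenvalue (Matrix.toLin' A) f₂) := by
  constructor
  · rintro c f₁ f₂ s hs ⟨S, hcard, hS⟩
    exact WNR.isCValue_foci_of_contactSet hs hcard
      (hS.trans (Set.inter_subset_inter_left _ (WNR.frontier_weightedRange_subset A c)))
  · rintro k hk hkn f₁ f₂ s hs ⟨S, ⟨hSE, hSc, hSn⟩, hS⟩
    obtain ⟨m, rfl⟩ := Nat.exists_eq_add_of_le' hk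
    -- Indices start at 0, so the k-th eigenvalue has index k - 1.
    let j : Fin n := ⟨m, hkn⟩
    -- A connected set with two points is infinite, so an arc supplies as many points as needed.
    obtain ⟨T, hTS, hT⟩ := (hSc.isPreconnected.infinite_of_nontrivial hSn).exists_subset_card_eq
      (2 * WNR.cDegree A (Pi.single j 1) + 1)
    have h := WNR.isCValue_foci_of_contactSet hs hT
      (fun z hz => ⟨WNR.frontier_subset_contactSet (WNR.rankRange_subset A j)
        (WNR.strict_subset_rankRange A j) (hS (hTS hz)), hSE (hTS hz)⟩)
    exact ⟨WNR.hasEigenvalue_of_isCValue_single h.1, WNR.hasEigenvalue_of_isCValue_single h.2⟩
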